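/- Setting. A template over a set $F$ with finite signature $(\mathrm{ar}_i)_{i\in I}$ is a family of relations $T_i\subseteq F^{\mathrm{ar}_i}$. A map $f:F\to F'$ is a homomorphism from $(T_i)$ to $(T'_i)$ if it maps $T_i$ (coordinatewise) into $T'_i$ for every $i$. Let $D,E$ be finite sets, $\phi:D\to E$ a map, and let $\Gamma=(\Gamma_P,\Gamma_Q)$ be a finite promise template: $\Gamma_P=\{P_i\subseteq D^{\mathrm{ar}_i}\}$ and $\Gamma_Q=\{Q_i\subseteq E^{\mathrm{ar}_i}\}$ have the same finite signature and $\phi$ is a homomorphism from $\Gamma_P$ to $\Gamma_Q$. An instance $\Psi$ is a conjunction of clauses $i(x_{v_1},\dots,x_{v_{\mathrm{ar}_i}})$ in variables $x_1,\dots,x_n$; $\Psi_P$ and $\Psi_Q$ are $\Psi$ with the symbols read as the $P_i$, respectively the $Q_i$. $\mathrm{PCSP}(\Gamma)$ is the promise problem: accept if $\Psi_P$ is satisfiable, reject if $\Psi_Q$ is not satisfiable. The search version: if $\Psi_P$ is satisfiable, output an assignment satisfying $\Psi_Q$. Let $R$ be a commutative ring whose elements are represented by bit strings (each element by at least one string,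 each string representing at most one element), and let $R'\subseteq R$ be a subring. The pair $(R',R)$ is LE-solvable if some algorithm, in time polynomial in the bit length of the input, takes any system of linear equations over $R$ in which some of the unknowns are restricted to $R'$ and the others range over $R$, and outputs a solution or reports correctly that there is none. For $S\subseteq R^k$ put $$\mathrm{Aff}_{R'}(S)=\Big\{\sum_{j=1}^{\ell} r_js^j : s^j\in S,\ r_j\in R',\ \sum_{j=1}^{\ell} r_j=1\Big\},\qquad \mathrm{LE}_{R'\subset R}=\{\mathrm{Aff}_{R'}(S) : k\ge 0,\ S\subseteq R^k \text{ finite}\}.$$ $\Gamma$ sandwiches $\mathrm{LE}_{R'\subset R}$ via $(g:D\to R,\ h:R\to E)$ if there are relations $T_i\in\mathrm{LE}_{R'\subset R}$ of arity $\mathrm{ar}_i$ such that $g$ is a homomorphism from $\Gamma_P$ to $(T_i)$ and $h$ is a homomorphism from $(T_i)$ to $\Gamma_Q$. $\mathsf P^h$ is the class of promise problems decidable in polynomial time with an oracle that, given a string representing $r\in R$, returns $h(r)$. Theorem. Let $(R',R)$ be an LE-solvable pair, and suppose that the finite promise template $\Gamma$ sandwiches $\mathrm{LE}_{R'\subset R}$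 via $(g,h)$. Then $\mathrm{PCSP}(\Gamma)\in\mathsf P^h$. Moreover, the search version of $\mathrm{PCSP}(\Gamma)$ is solved in polynomial time with oracle access to $h$, by an algorithm that on every instance $\Psi$ with variables $x_1,\dots,x_n$ either rejects, which happens exactly when the affine relaxation of $\Psi$ (find $w\in R^n$ such that $(w_{v_1},\dots,w_{v_{\mathrm{ar}_i}})\in\mathrm{Aff}_{R'}(g(P_i))$ for every clause $i(x_{v_1},\dots,x_{v_{\mathrm{ar}_i}})$) has no solution, or outputs $(h(w_1),\dots,h(w_n))$ for a solution $w$ of the affine relaxation. -/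

import Mathlib

namespace PromiseCSP

/-! ## Templates, promise templates and homomorphic sandwiches -/

/-- A template over the domain `F` with signature `ar : I → ℕ`: one relation `P i ⊆ F ^ (ar i)` for
every index `i`. -/
abbrev Template {I : Type} (F : Type*) (ar : I → ℕ) : Type _ :=
  ∀ i : I, Set (Fin (ar i) → F)

/-- `f` is a homomorphism between two templates of the same signature: `f (P i) ⊆ P' i`. -/
def IsHom {I : Type} {F F' : Type*} {ar : I → ℕ} (f : F → F') (P : Template F ar)
    (P' : Template F' ar) : Prop :=
  ∀ (i : I), ∀ x ∈ P i, f ∘ x ∈ P' i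

/-- A promise template over the promise domain `(D, E, φ)` with signature `ar`. -/
structure PromiseTemplate {D E I : Type} (φ : D → E) (ar : I → ℕ) where
  P : Template D ar
  Q : Template E ar
  hom : IsHom φ P Q

/-- The promise template `Γ` homomorphically sandwiches the template `T` via `(g, h)`. -/
def PromiseTemplate.SandwichesTemplate {D E I : Type} {φ : D → E} {ar : I → ℕ}
    (Γ : PromiseTemplate φ ar) {F : Type*} (T : Template F ar) (g : D → F) (h : F → E) : Prop :=
  IsHom g Γ.P T ∧ IsHom h T Γ.Q

/-- `Γ` sandwiches a set of relations over `F` (`L k` holds those of arity `k`) via `(g, h)`: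
it sandwiches some template of its own signature all of whose relations belong to the set. -/
def PromiseTemplate.Sandwiches {D E I : Type} {φ : D → E} {ar : I → ℕ}
    (Γ : PromiseTemplate φ ar) {F : Type*} (L : ∀ k : ℕ, Set (Set (Fin k → F)))
    (g : D → F) (h : F → E) : Prop :=
  ∃ T : Template F ar, (∀ i, T i ∈ L (ar i)) ∧ Γ.SandwichesTemplate T g h

/-! ## Affine hulls -/

/-- The affine hull of `S ⊆ R ^ k` with coefficients in the subring `R'`. -/
def affineHull {R : Type*} [CommRing R] (R' : Subring R) {k : ℕ} (S : Set (Fin k → R)) :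
    Set (Fin k → R) :=
  {x | ∃ (l : ℕ) (r : Fin l → R') (s : Fin l → Fin k → R),
    (∀ j, s j ∈ S) ∧ ∑ j, r j = 1 ∧ x = ∑ j, (r j : R) • s j}

/-- The infinite template of all affine hulls over `R'` of finite sets of tuples over `R`, by
arity. -/
def LE {R : Type*} [CommRing R] (R' : Subring R) (k : ℕ) : Set (Set (Fin k → R)) :=
  {T | ∃ S : Set (Fin k → R), S.Finite ∧ T = affineHull R' S}

/-! ## Formulae and the problems `PCSP` and search `PCSP` -/

/-- A CNF formula over the signature `ar` in the variables `x_0, …, x_(n-1)`: a finite list of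
clauses, each naming a relation and the variables it is applied to. -/
structure Formula {I : Type} (ar : I → ℕ) where
  n : ℕ
  clauses : List (Σ i : I, Fin (ar i) → Fin n)

/-- The assignment `x` satisfies the formula when its relation symbols are read in `P`. -/
def Formula.SatisfiedBy {I : Type} {ar : I → ℕ} (Ψ : Formula ar) {F : Type*} (P : Template F ar)
    (x : Fin Ψ.n → F) : Prop :=
  ∀ c ∈ Ψ.clauses, x ∘ c.2 ∈ P c.1

/-- The formula is satisfiable when its relation symbols are read in `P`. -/
def Formula.Satisfiable {I : Type} {ar : I → ℕ} (Ψ : Formula ar) {F : Type*}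
    (P : Template F ar) : Prop :=
  ∃ x : Fin Ψ.n → F, Ψ.SatisfiedBy P x

/-- A promise decision problem: instances to be accepted and instances to be rejected. -/
structure PromiseProblem (α : Type) where
  yes : Set α
  no : Set α

/-- The promise problem `PCSP(Γ)`: accept if `Ψ_P` is satisfiable, reject if `Ψ_Q` is not. -/
def PCSP {D E I : Type} {φ : D → E} {ar : I → ℕ} (Γ : PromiseTemplate φ ar) :
    PromiseProblem (Formula ar) where
  yes := {Ψ | Ψ.Satisfiable Γ.P}
  no := {Ψ | ¬ Ψ.Satisfiable Γ.Q}

/-- An output of search `PCSP(Γ)` (`none` stands for "reject") is correct: if `Ψ_P` is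
satisfiable, the output is an assignment that satisfies `Ψ_Q`. -/
def SearchCorrect {D E I : Type} {φ : D → E} {ar : I → ℕ} (Γ : PromiseTemplate φ ar)
    (Ψ : Formula ar) (out : Option (Fin Ψ.n → E)) : Prop :=
  Ψ.Satisfiable Γ.P → ∃ y, out = some y ∧ Ψ.SatisfiedBy Γ.Q y

/-- The affine relaxation of `P` along `g : D → R`, as a template over `R`: every relation `P i` is
replaced by the affine hull of its image. -/
def affineRelaxation {D I : Type} {ar : I → ℕ} {R : Type*} [CommRing R] (R' : Subring R)
    (P : Template D ar) (g : D → R) : Template R ar :=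
  fun i => affineHull R' ((fun x => g ∘ x) '' P i)

/-- The output is obtained by solving the affine relaxation and rounding with `h`: it is "reject"
and the relaxation has no solution, or it is `h ∘ w` for a solution `w` of the relaxation. -/
def RoundsAffineRelaxation {D E I : Type} {φ : D → E} {ar : I → ℕ} (Γ : PromiseTemplate φ ar)
    {R : Type*} [CommRing R] (R' : Subring R) (g : D → R) (h : R → E)
    (Ψ : Formula ar) (out : Option (Fin Ψ.n → E)) : Prop :=
  (out = none ∧ ¬ Ψ.Satisfiable (affineRelaxation R' Γ.P g)) ∨
    ∃ w : Fin Ψ.n → R, Ψ.SatisfiedBy (affineRelaxation R' Γ.P g) w ∧ out = some (h ∘ w)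

/-! ## Encodings -/

/-- The alphabet in which formulae are written. -/
inductive FormulaSym (I : Type) : Type
  | tick : FormulaSym I
  | endMark : FormulaSym I
  | rel (i : I) : FormulaSym I

/-- A number in unary, with an end mark. -/
def encodeIndex {I : Type} (k : ℕ) : List (FormulaSym I) :=
  List.replicate k FormulaSym.tick ++ [FormulaSym.endMark]

/-- A formula is written as its number of variables, followed by its clauses; a clause is written
as its relation symbol, followed by its variables. -/
def encodeFormula {I : Type} {ar : I → ℕ} (Ψ : Formula ar) : List (FormulaSym I) :=
  encodeIndex Ψ.n ++ Ψ.clauses.flatMap fun c =>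
    FormulaSym.rel c.1 :: (List.ofFn c.2).flatMap fun v => encodeIndex v.val

/-- An assignment is written as the list of its values, and "reject" as the single letter
`none`. -/
def encodeAssignment {E : Type} {n : ℕ} : Option (Fin n → E) → List (Option E)
  | none => [none]
  | some y => (List.ofFn y).map some

/-- A representation of the elements of `R` by bit strings. Every element has at least one code,
possibly several. -/
structure BitRep (R : Type*) where
  IsCode : Set (List Bool)
  val : IsCode → R
  surj : Function.Surjective val

/-- The alphabet in which systems of linear equations and their solutions are written. -/
inductive Sym : Type
  | bit (b : Bool) : Sym
  | comma : Sym
  | semicolon : Sym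

/-- A bit string, with an end mark. -/
def encodeWord (w : List Bool) : List Sym :=
  w.map Sym.bit ++ [Sym.comma]

/-- A system `A x = b` of `m` linear equations over `R` in `n` unknowns, given by codes of its
entries. The unknowns `x j` with `restricted j = true` range over the subring, the others over
`R`. -/
structure LinSystem {R : Type*} (ρ : BitRep R) where
  m : ℕ
  n : ℕ
  restricted : Fin n → Bool
  A : Fin m → Fin n → ρ.IsCode
  b : Fin m → ρ.IsCode

/-- `x` solves the system, with restricted unknowns in the subring `R'`. -/
def LinSystem.IsSolution {R : Type*} [CommRing R] {ρ : BitRep R} (S : LinSystem ρ)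
    (R' : Subring R) (x : Fin S.n → R) : Prop :=
  (∀ i, ∑ j, ρ.val (S.A i j) * x j = ρ.val (S.b i)) ∧ ∀ j, S.restricted j = true → x j ∈ R'

/-- A system is written as its list of restriction flags, followed by the rows of the augmented
matrix `(A | b)`. -/
def LinSystem.encode {R : Type*} {ρ : BitRep R} (S : LinSystem ρ) : List Sym :=
  (List.ofFn S.restricted).map Sym.bit ++ [Sym.semicolon] ++
    (List.ofFn fun i => ((List.ofFn (S.A i)).flatMap fun a => encodeWord (a : List Bool)) ++
      encodeWord (S.b i : List Bool) ++ [Sym.semicolon]).flatten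

/-- The answer to a system: "no solution", or the list of the codes of a solution. -/
def encodeSolution {R : Type*} {ρ : BitRep R} {n : ℕ} : Option (Fin n → ρ.IsCode) → List Sym
  | none => [Sym.bit false]
  | some x => Sym.bit true :: (List.ofFn x).flatMap fun a => encodeWord (a : List Bool)

/-- The answer is right: a solution if there is one, and "no solution" otherwise. -/
def LinSystem.CorrectAnswer {R : Type*} [CommRing R] {ρ : BitRep R} (S : LinSystem ρ)
    (R' : Subring R) : Option (Fin S.n → ρ.IsCode) → Prop
  | none => ¬ ∃ x : Fin S.n → R, S.IsSolution R' x
  | some x => S.IsSolution R' fun j => ρ.val (x j)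

/-! ## Polynomial time, with and without an oracle -/

/-- The pair `R' ⊆ R` (with elements of `R` represented by `ρ`) is LE-solvable: a Turing machine
solves, in time polynomial in the bit length of the input, all systems of linear equations over `R`
some of whose unknowns may be restricted to `R'`. -/
def LESolvablePair {R : Type*} [CommRing R] (ρ : BitRep R) (R' : Subring R) : Prop :=
  ∃ (M : Turing.TM2ComputableAux Sym Sym) (p : Polynomial ℕ), ∀ S : LinSystem ρ,
    ∃ out : Option (Fin S.n → ρ.IsCode), S.CorrectAnswer R' out ∧
      Nonempty (Turing.TM2OutputsInTime M.tm (S.encode.map M.inputAlphabet.invFun)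
        (some ((encodeSolution out).map M.outputAlphabet.invFun)) (p.eval S.encode.length))

/-- A Turing machine with an oracle that maps bit strings to elements of the finite set `X`.
One of its stacks is the query stack. In the state `ask` the machine queries the oracle, and the
answer `x` sends it to the state `resume x` (for `X = {yes, no}`: the usual states `q_yes` and
`q_no`). -/
structure OracleTM (X Γ₀ Γ₁ : Type) extends Turing.TM2ComputableAux Γ₀ Γ₁ where
  queryStack : tm.K
  queryAlphabet : tm.Γ queryStack ≃ Bool
  ask : tm.Λ
  resume : X → tm.Λ

open Classical in
/-- One step of a machine with oracle `O`. A query is a single step: it passes the word on the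
query stack (top symbol first) to the oracle and empties that stack. -/
noncomputable def OracleTM.step {X Γ₀ Γ₁ : Type} (M : OracleTM X Γ₀ Γ₁) (O : List Bool → X)
    (c : Turing.TM2.Cfg M.tm.Γ M.tm.Λ M.tm.σ) : Option (Turing.TM2.Cfg M.tm.Γ M.tm.Λ M.tm.σ) :=
  if c.l = some M.ask then
    some
      { l := some (M.resume (O ((c.stk M.queryStack).map M.queryAlphabet)))
        var := c.var
        stk := Function.update c.stk M.queryStack [] }
  else Turing.TM2.step M.tm.m c

/-- With oracle `O`, the machine halts on the input `l` within `t` steps and outputs `l'`. -/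
def OracleTM.OutputsInTime {X Γ₀ Γ₁ : Type} (M : OracleTM X Γ₀ Γ₁) (O : List Bool → X)
    (l : List Γ₀) (l' : List Γ₁) (t : ℕ) : Prop :=
  Nonempty (StateTransition.EvalsToInTime (M.step O)
    (Turing.initList M.tm (l.map M.inputAlphabet.invFun))
    (some (Turing.haltList M.tm (l'.map M.outputAlphabet.invFun))) t)

/-- `O` is an oracle for `h : R → E`: given any code of `r`, it answers `h r`. Its answers to
strings that are not codes are arbitrary. -/
def IsOracleFor {R : Type*} (ρ : BitRep R) {E : Type} (h : R → E) (O : List Bool → E) : Prop :=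
  ∀ c : ρ.IsCode, O c = h (ρ.val c)

/-- Some machine with oracle access to `h` computes, in time polynomial in the length of the input,
for every instance `a` an output `b` with `Spec a b`. -/
def PolyTimeWithOracle {R : Type*} (ρ : BitRep R) {E : Type} (h : R → E) {α : Type}
    {β : α → Type} {Γ₀ Γ₁ : Type} (encIn : α → List Γ₀) (encOut : ∀ a, β a → List Γ₁)
    (Spec : ∀ a, β a → Prop) : Prop :=
  ∃ (M : OracleTM E Γ₀ Γ₁) (p : Polynomial ℕ), ∀ O : List Bool → E, IsOracleFor ρ h O →
    ∀ a : α, ∃ b : β a, Spec a b ∧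
      M.OutputsInTime O (encIn a) (encOut a b) (p.eval (encIn a).length)

/-- The promise problem `L` belongs to `P^h`. -/
def InPOracle {R : Type*} (ρ : BitRep R) {E : Type} (h : R → E) {α : Type} {Γ₀ : Type}
    (encIn : α → List Γ₀) (L : PromiseProblem α) : Prop :=
  PolyTimeWithOracle ρ h encIn (β := fun _ => Bool) (fun _ b => [b])
    fun a b => (a ∈ L.yes → b = true) ∧ (a ∈ L.no → b = false)

end PromiseCSP

/-! The affine relaxation of a formula Ψ lies between `Ψ_P` and `Ψ_Q`. It is implied by `Ψ_P` along
`g`, since `g(P_i)` lies in its own hull. Conversely, a hull `T_i` that contains `g(P_i)` also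
contains the hull of `g(P_i)` (`affineHull_subset`), and `h` maps `T_i` into `Q_i`; so `h` maps the
relaxed relations into the `Q_i` (`isHom_of_sandwiches`). Hence an unsolvable relaxation refutes
`Ψ_P`, and `h ∘ w` satisfies `Ψ_Q` for every solution `w`.

The relaxation is a linear system. A tuple lies in the hull of the finite set `g(P_i)` iff it is a
combination of its members with coefficients in `R'` that sum up to 1 (`mem_affineHull_range_iff`).
A clause thus contributes one restricted unknown per element of `P_i` and `ar_i + 1` equations; the
values `w_j` are the unrestricted unknowns. Since Γ is fixed, the entries come from finitely many
codes, which are constants of the program, and the system has polynomial length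
(`Describes.length_systemString_le`).

The rest implements this on a stack machine: it writes the system (`runs_generate`), simulates the
solver on embedded stacks (`runs_solver`), queries the oracle at the codes of the `w_j`
(`runs_nextVar`) and empties its stacks (`runs_clear`). The codes that the solver returns have
polynomial length because a machine pushes boundedly many letters per step
(`length_le_of_outputsInTime`). `Describes` is the interface between algebra and machine, and
`Describes.encode_system` identifies the string on the stack with the encoding of a linear system.
`Describes.exists_polynomial` combines everything; the decision and the search version differ only
in the words that the machine emits. -/

namespace PromiseCSP

/-! ## Runs of bounded length -/

/-- `f` leads from `a` to `b` in at most `t` steps. -/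
def RunsTo {C : Type*} (f : C → Option C) (t : ℕ) (a b : C) : Prop :=
  ∃ s ≤ t, (flip bind f)^[s] (some a) = some b

namespace RunsTo

variable {C : Type*} {f : C → Option C}

theorem refl (a : C) : RunsTo f 0 a a := ⟨0, le_rfl, rfl⟩

theorem mono {t t' : ℕ} {a b : C} (h : RunsTo f t a b) (ht : t ≤ t') : RunsTo f t' a b :=
  let ⟨s, hs, e⟩ := h; ⟨s, hs.trans ht, e⟩

theorem trans {t t' : ℕ} {a b c : C} (h : RunsTo f t a b) (h' : RunsTo f t' b c) :
    RunsTo f (t + t') a c := by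
  obtain ⟨s, hs, e⟩ := h
  obtain ⟨s', hs', e'⟩ := h'
  exact ⟨s' + s, by omega, by rw [Function.iterate_add_apply, e, e']⟩

theorem single {a b : C} (h : f a = some b) : RunsTo f 1 a b := ⟨1, le_rfl, h⟩

theorem evalsToInTime {t : ℕ} {a b : C} (h : RunsTo f t a b) :
    Nonempty (StateTransition.EvalsToInTime f a (some b) t) :=
  let ⟨s, hs, e⟩ := h; ⟨⟨⟨s, e⟩, hs⟩⟩

end RunsTo

theorem iterate_bind_none {C : Type*} (f : C → Option C) (s : ℕ) :
    (flip bind f)^[s] none = none := by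
  induction s with
  | zero => rfl
  | succ s ih => rw [Function.iterate_succ_apply]; exact ih

/-- A simulation that maps every step of `f` to a step of `g` maps runs to runs. -/
theorem iterate_bind_map {C C' : Type*} {f : C → Option C} {g : C' → Option C'} (F : C → C')
    (H : ∀ a b, f a = some b → g (F a) = some (F b)) (s : ℕ) (a b : C)
    (h : (flip bind f)^[s] (some a) = some b) : (flip bind g)^[s] (some (F a)) = some (F b) := by
  induction s generalizing a with
  | zero => simpa using congrArg F (Option.some.inj h)
  | succ s ih =>
    rw [Function.iterate_succ_apply] at h ⊢
    change (flip bind f)^[s] (f a) = _ at h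
    change (flip bind g)^[s] (g (F a)) = _
    cases e : f a with
    | none => rw [e, iterate_bind_none] at h; cases h
    | some c => rw [H a c e]; rw [e] at h; exact ih c h

/-! ## The length of the stacks of a running machine -/

section StackLength

open Turing

variable {K : Type} [DecidableEq K] {Γ : K → Type} {Λ σ : Type}

/-- The number of `push` instructions in a statement. -/
def pushCount : TM2.Stmt Γ Λ σ → ℕ
  | .push _ _ q => pushCount q + 1
  | .peek _ _ q => pushCount q
  | .pop _ _ q => pushCount q
  | .load _ q => pushCount q
  | .branch _ q₁ q₂ => pushCount q₁ + pushCount q₂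
  | .goto _ => 0
  | .halt => 0

/-- A statement is loop-free, so each of its `push` instructions is executed at most once. Adding up
both sides of a branch is crude but sufficient. -/
theorem length_stk_stepAux_le (q : TM2.Stmt Γ Λ σ) (v : σ) (S : ∀ k, List (Γ k)) (k : K) :
    ((TM2.stepAux q v S).stk k).length ≤ (S k).length + pushCount q := by
  induction q generalizing v S with
  | push k' f q ih =>
    refine (ih _ _).trans ?_
    rcases eq_or_ne k k' with rfl | hk
    · simp [pushCount]; omega
    · simp [pushCount, Function.update_of_ne hk]
  | pop k' f q ih =>
    refine (ih _ _).trans ?_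
    rcases eq_or_ne k k' with rfl | hk
    · simp [pushCount]
    · simp [pushCount, Function.update_of_ne hk]
  | peek k' f q ih => exact ih _ _
  | load f q ih => exact ih _ _
  | branch f q₁ q₂ ih₁ ih₂ =>
    have h₁ := ih₁ v S
    have h₂ := ih₂ v S
    simp only [TM2.stepAux, pushCount]
    cases f v <;> simp only [cond_true, cond_false] <;> omega
  | goto => simp [pushCount]
  | halt => simp [pushCount]

/-- This bounds the length of the solution that the solver outputs, hence the time needed to read it
and to pass its words to the oracle. -/
theorem length_stk_iterate_le (m : Λ → TM2.Stmt Γ Λ σ) (B : ℕ) (hB : ∀ l, pushCount (m l) ≤ B)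
    (k : K) (s : ℕ) (a b : TM2.Cfg Γ Λ σ)
    (h : (flip bind (TM2.step m))^[s] (some a) = some b) :
    (b.stk k).length ≤ (a.stk k).length + s * B := by
  induction s generalizing a with
  | zero => simp only [Function.iterate_zero, id, Option.some.injEq] at h; simp [h]
  | succ s ih =>
    rw [Function.iterate_succ_apply] at h
    change (flip bind (TM2.step m))^[s] (TM2.step m a) = _ at h
    obtain ⟨l, v, S⟩ := a
    cases l with
    | none => rw [TM2.step, iterate_bind_none] at h; cases h
    | some l =>
      have h₁ := ih _ h
      have h₂ := length_stk_stepAux_le (m l) v S k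
      have h₃ := hB l
      rw [add_mul, one_mul]
      simp only at h₁ ⊢
      omega

end StackLength

/-- `initList` transports the input along an equality of stack names; the form with
`Function.update` is the one `simp` can compute with. -/
theorem initList_stk (tm : Turing.FinTM2) (s : List (tm.Γ tm.k₀)) :
    (Turing.initList tm s).stk = Function.update (fun _ => []) tm.k₀ s := by
  funext k
  simp only [Turing.initList, Function.update, eq_mpr_eq_cast]
  split_ifs with h
  · subst h; rfl
  · rfl

theorem haltList_stk (tm : Turing.FinTM2) (s : List (tm.Γ tm.k₁)) :
    (Turing.haltList tm s).stk = Function.update (fun _ => []) tm.k₁ s := by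
  funext k
  simp only [Turing.haltList, Function.update, eq_mpr_eq_cast]
  split_ifs with h
  · subst h; rfl
  · rfl

/-- A machine that produces the output `l'` on the input `l` within `t` steps. -/
theorem length_le_of_outputsInTime (tm : Turing.FinTM2) (B : ℕ)
    (hB : ∀ l, pushCount (tm.m l) ≤ B) (l : List (tm.Γ tm.k₀)) (l' : List (tm.Γ tm.k₁)) (t : ℕ)
    (h : Nonempty (Turing.TM2OutputsInTime tm l (some l') t)) :
    l'.length ≤ l.length + t * B := by
  obtain ⟨⟨⟨s, e⟩, hs⟩⟩ := h
  have := length_stk_iterate_le tm.m B hB tm.k₁ s _ _ e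
  have h₀ := congrFun (haltList_stk tm l') tm.k₁
  have h₁ := congrFun (initList_stk tm l) tm.k₁
  have h₂ : ((Turing.initList tm l).stk tm.k₁).length ≤ l.length := by
    rw [h₁]
    rcases eq_or_ne tm.k₁ tm.k₀ with hk | hk
    · rw [hk]; simp
    · simp [Function.update_of_ne hk]
  have h₃ : ((Turing.haltList tm l').stk tm.k₁).length = l'.length := by rw [h₀]; simp
  have h₄ : s * B ≤ t * B := Nat.mul_le_mul_right B hs
  rw [← h₃]
  exact this.trans (by omega)

/-! ## Auxiliary statements for stack machines -/

section Statements

open Turing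

variable {K : Type} [DecidableEq K] {Γ : K → Type} {Λ σ : Type}

/-- Push the letters of `l` one after the other. -/
def pushList (k : K) (l : List (Γ k)) (q : TM2.Stmt Γ Λ σ) : TM2.Stmt Γ Λ σ :=
  l.foldr (fun a q => .push k (fun _ => a) q) q

/-- Remove the top `n` letters. -/
def dropTop (k : K) : ℕ → TM2.Stmt Γ Λ σ → TM2.Stmt Γ Λ σ
  | 0, q => q
  | n + 1, q => .pop k (fun v _ => v) (dropTop k n q)

/-- Pop a letter and jump to a label that depends on it. -/
def popGoto {σ : Type} (k : K) (f : Option (Γ k) → Λ) : TM2.Stmt Γ Λ (σ × Λ) :=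
  .pop k (fun v o => (v.1, f o)) (.goto Prod.snd)

@[simp]
theorem stepAux_pushList (k : K) (l : List (Γ k)) (q : TM2.Stmt Γ Λ σ) (v : σ)
    (S : ∀ k, List (Γ k)) :
    TM2.stepAux (pushList k l q) v S =
      TM2.stepAux q v (Function.update S k (l.reverse ++ S k)) := by
  induction l generalizing S with
  | nil => simp [pushList]
  | cons a l ih =>
    change TM2.stepAux (pushList k l q) v (Function.update S k (a :: S k)) = _
    rw [ih]; simp

@[simp]
theorem stepAux_dropTop (k : K) (n : ℕ) (q : TM2.Stmt Γ Λ σ) (v : σ) (S : ∀ k, List (Γ k)) :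
    TM2.stepAux (dropTop k n q) v S =
      TM2.stepAux q v (Function.update S k ((S k).drop n)) := by
  induction n generalizing S with
  | zero => simp [dropTop]
  | succ n ih => simp [dropTop, ih]

@[simp]
theorem stepAux_popGoto {σ : Type} (k : K) (f : Option (Γ k) → Λ) (v : σ × Λ)
    (S : ∀ k, List (Γ k)) :
    TM2.stepAux (popGoto k f) v S =
      ⟨some (f (S k).head?), (v.1, f (S k).head?), Function.update S k (S k).tail⟩ := rfl

end Statements

/-! ## The machine that solves the affine relaxation and rounds the solution -/

/-- The equations for a clause `i (x_{v_1}, …)`: the coefficients of the affine combination sum up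
to `1` (`none`), and the combination has the right `j`-th coordinate (`some j`). -/
abbrev Row {I : Type} (ar : I → ℕ) : Type := Σ i : I, Option (Fin (ar i))

/-- The stacks that hold numbers in unary. -/
inductive Counter : Type
  | vars | before | after
  deriving DecidableEq

/-- The stacks of the rounding machine, apart from those of the solver. -/
inductive Reg : Type
  | inp | copy | count (c : Counter) | tmp | gen | word | query | ans | out
  deriving DecidableEq

/-- The solver, and the finite data that the rounding machine depends on. -/
structure RoundingProgram {R : Type*} (ρ : BitRep R) {I : Type} (ar : I → ℕ) (E Γ₁ : Type) where
  solver : Turing.TM2ComputableAux Sym Sym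
  zero : ρ.IsCode
  negOne : ρ.IsCode
  size : I → ℕ
  coeff : Row ar → List ρ.IsCode
  rhs : Row ar → ρ.IsCode
  emit : E → List Γ₁
  accept : List Γ₁
  reject : List Γ₁

/-- The labels of the rounding machine. -/
inductive Label {I : Type} (ar : I → ℕ) (E Λ : Type) : Type
  | readVars (e : Bool)
  | readClauses (o : Option (FormulaSym I))
  | restore (o : Option (FormulaSym I))
  | separator
  | clause
  | zeros (c : Counter) (r : Row ar) (e : Bool)
  | recount (c : Counter) (r : Row ar) (e : Bool)
  | block (r : Row ar)
  | const (r : Row ar)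
  | index (r : Σ i, Fin (ar i)) (e : Bool)
  | entry (r : Σ i, Fin (ar i))
  | close (i : I)
  | feed (o : Option Sym)
  | run (q : Λ)
  | verdict
  | accepted
  | rejected
  | nextVar
  | readWord (o : Option Bool)
  | turn (o : Option Bool)
  | ask
  | answer (e : E)
  | clearSolution
  | clearVars
  | clearBefore
  | output (o : Option E)
  | final

instance {I : Type} [Finite I] : Finite (FormulaSym I) :=
  Finite.of_equiv _ (proxy_equiv% (FormulaSym I))

instance : Finite Sym := Finite.of_equiv _ (proxy_equiv% Sym)

instance : Finite Counter := Finite.of_equiv _ (proxy_equiv% Counter)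

instance : Finite Reg := Finite.of_equiv _ (proxy_equiv% Reg)

instance {I : Type} [Finite I] (ar : I → ℕ) (E Λ : Type) [Finite E] [Finite Λ] :
    Finite (Label ar E Λ) :=
  Finite.of_equiv _ (proxy_equiv% (Label ar E Λ))

namespace RoundingProgram

open Turing

variable {R : Type*} {ρ : BitRep R} {I : Type} {ar : I → ℕ} {E Γ₁ : Type}

/-- The labels. -/
abbrev Lbl (P : RoundingProgram ρ ar E Γ₁) : Type := Label ar E P.solver.tm.Λ

/-- The stacks. -/
abbrev Stk (P : RoundingProgram ρ ar E Γ₁) : Type := Reg ⊕ P.solver.tm.K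

/-- The alphabets of the stacks. -/
abbrev Alph (P : RoundingProgram ρ ar E Γ₁) : P.Stk → Type
  | .inl .inp => FormulaSym I
  | .inl .copy => FormulaSym I
  | .inl (.count _) => Unit
  | .inl .tmp => Unit
  | .inl .gen => Sym
  | .inl .word => Bool
  | .inl .query => Bool
  | .inl .ans => E
  | .inl .out => Γ₁
  | .inr k => P.solver.tm.Γ k

/-- The internal states: those of the solver, and a label to jump to. -/
abbrev State (P : RoundingProgram ρ ar E Γ₁) : Type := P.solver.tm.σ × P.Lbl

/-- The statements. -/
abbrev Stm (P : RoundingProgram ρ ar E Γ₁) : Type := TM2.Stmt P.Alph P.Lbl P.State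

/-- The statements of the solver as statements of the rounding machine. -/
def lift (P : RoundingProgram ρ ar E Γ₁) :
    TM2.Stmt P.solver.tm.Γ P.solver.tm.Λ P.solver.tm.σ → P.Stm
  | .push k f q => .push (.inr k) (fun v => f v.1) (P.lift q)
  | .peek k f q => .peek (.inr k) (fun v o => (f v.1 o, v.2)) (P.lift q)
  | .pop k f q => .pop (.inr k) (fun v o => (f v.1 o, v.2)) (P.lift q)
  | .load f q => .load (fun v => (f v.1, v.2)) (P.lift q)
  | .branch f q₁ q₂ => .branch (fun v => f v.1) (P.lift q₁) (P.lift q₂)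
  | .goto f => .goto fun v => .run (f v.1)
  | .halt => .goto fun _ => .verdict

/-- The label at which the `j`-th equation of a clause starts, if there is one. -/
def rowLabel (P : RoundingProgram ρ ar E Γ₁) (i : I) (j : ℕ) : P.Lbl :=
  if h : j < ar i then .index ⟨i, ⟨j, h⟩⟩ false else .close i

/-- The label after an equation. -/
def nextLabel (P : RoundingProgram ρ ar E Γ₁) : Row ar → P.Lbl
  | ⟨i, none⟩ => P.rowLabel i 0
  | ⟨i, some j⟩ => P.rowLabel i (j + 1)

/-- Push ticks on a counter. -/
def tick (P : RoundingProgram ρ ar E Γ₁) (c : Counter) (n : ℕ) (q : P.Stm) : P.Stm :=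
  pushList (.inl (.count c)) (List.replicate n ()) q

/-- Pop a tick from a counter, and jump according to whether there was one. -/
def untick (P : RoundingProgram ρ ar E Γ₁) (c : Counter) (l l' : P.Lbl) : P.Stm :=
  popGoto (.inl (.count c)) fun
    | some _ => l
    | none => l'

/-- The number of unknowns for a clause that begins with the given letter. -/
def symSize (P : RoundingProgram ρ ar E Γ₁) : FormulaSym I → ℕ
  | .rel i => P.size i
  | _ => 0

/-- The label after the zeros of a counter have been written. -/
def afterZeros (P : RoundingProgram ρ ar E Γ₁) : Counter → Row ar → P.Lbl
  | .vars, r => .zeros .before r false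
  | .before, r => .block r
  | .after, r => .const r

/-- A code of a ring element, with an end mark. -/
def wordOf (a : ρ.IsCode) : List Sym := encodeWord (a : List Bool)

/-- The program of the rounding machine. -/
def prog (P : RoundingProgram ρ ar E Γ₁) : P.Lbl → P.Stm
  -- A popped letter is known only to the jump that follows. The next label carries it and acts on
  -- it at the start of the next visit; `false` and `none` mean that no letter is pending.
  | .readVars e =>
    P.tick .vars e.toNat <| pushList (.inl .gen) (List.replicate e.toNat (Sym.bit false)) <|
      popGoto (.inl .inp) fun
        | some .tick => .readVars true
        | _ => .readClauses none
  -- The restriction flags precede all equations, so the unknowns are counted in a pass of their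
  -- own, and the input is kept on `copy` for a second pass.
  | .readClauses o =>
    pushList (.inl .copy) o.toList <|
      P.tick .after (o.toList.map P.symSize).sum <|
      pushList (.inl .gen) (List.replicate (o.toList.map P.symSize).sum (Sym.bit true)) <|
      popGoto (.inl .inp) fun
        | some s => .readClauses (some s)
        | none => .restore none
  | .restore o =>
    pushList (.inl .inp) o.toList <|
      popGoto (.inl .copy) fun
        | some s => .restore (some s)
        | none => .separator
  | .separator => pushList (.inl .gen) [Sym.semicolon] <| .goto fun _ => .clause
  | .clause =>
    popGoto (.inl .inp) fun
      | some (.rel i) => .zeros .vars ⟨i, none⟩ false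
      | _ => .feed none
  -- Reading a counter empties it. Its ticks are parked on `tmp`, and `recount` moves them back.
  | .zeros c r e =>
    pushList (.inl .gen) (List.replicate e.toNat (wordOf P.zero)).flatten <|
      pushList (.inl .tmp) (List.replicate e.toNat ()) <|
      P.untick c (.zeros c r true) (.recount c r false)
  | .recount c r e =>
    P.tick c e.toNat <| popGoto (.inl .tmp) fun
      | some _ => .recount c r true
      | none => P.afterZeros c r
  -- The first equation of a clause takes its own unknowns off `after`; `close` adds them to
  -- `before`.
  | .block r =>
    dropTop (.inl (.count .after)) (r.2.elim (P.size r.1) fun _ => 0) <|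
      pushList (.inl .gen) ((P.coeff r).flatMap wordOf) <|
      .goto fun _ => .zeros .after r false
  | .const r =>
    pushList (.inl .gen) (wordOf (P.rhs r) ++ [Sym.semicolon]) <| .goto fun _ => P.nextLabel r
  -- The ticks of the index `v` are moved from `vars` to `tmp`, and `entry` moves one more. So
  -- `zeros .vars` writes only the zeros behind the entry `-1`, and `recount` restores `n`.
  | .index r e =>
    dropTop (.inl (.count .vars)) e.toNat <| pushList (.inl .tmp) (List.replicate e.toNat ()) <|
      pushList (.inl .gen) (List.replicate e.toNat (wordOf P.zero)).flatten <|
      popGoto (.inl .inp) fun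
        | some .tick => .index r true
        | _ => .entry r
  | .entry r =>
    dropTop (.inl (.count .vars)) 1 <| pushList (.inl .tmp) [()] <|
      pushList (.inl .gen) (wordOf P.negOne) <|
      .goto fun _ => .zeros .vars ⟨r.1, some r.2⟩ false
  | .close i =>
    P.tick .before (P.size i) <| .goto fun _ => .clause
  | .feed o =>
    pushList (.inr P.solver.tm.k₀) (o.toList.map P.solver.inputAlphabet.invFun) <|
      popGoto (.inl .gen) fun
        | some s => .feed (some s)
        | none => .run P.solver.tm.main
  | .run q => P.lift (P.solver.tm.m q)
  | .verdict =>
    popGoto (.inr P.solver.tm.k₁) fun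
      | some a =>
        match P.solver.outputAlphabet a with
        | .bit true => .accepted
        | _ => .rejected
      | none => .rejected
  | .accepted => pushList (.inl .out) P.accept.reverse <| .goto fun _ => .nextVar
  | .rejected => pushList (.inl .out) P.reject.reverse <| .goto fun _ => .clearSolution
  | .nextVar => P.untick .vars (.readWord none) .clearSolution
  | .readWord o =>
    pushList (.inl .word) o.toList <|
      popGoto (.inr P.solver.tm.k₁) fun
        | some a =>
          match P.solver.outputAlphabet a with
          | .bit b => .readWord (some b)
          | _ => .turn none
        | none => .turn none
  | .turn o =>
    pushList (.inl .query) o.toList <|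
      popGoto (.inl .word) fun
        | some b => .turn (some b)
        | none => .ask
  -- Never executed, since `OracleTM.step` intercepts this label.
  | .ask => .halt
  | .answer e => pushList (.inl .ans) [e] <| .goto fun _ => .nextVar
  | .clearSolution =>
    popGoto (.inr P.solver.tm.k₁) fun
      | some _ => .clearSolution
      | none => .clearVars
  | .clearVars => P.untick .vars .clearVars .clearBefore
  | .clearBefore => P.untick .before .clearBefore (.output none)
  | .output o =>
    pushList (.inl .out) (o.toList.flatMap P.emit).reverse <|
      popGoto (.inl .ans) fun
        | some e => .output (some e)
        | none => .final
  -- The halting configuration `haltList` requires the initial internal state.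
  | .final => .load (fun _ => (P.solver.tm.initialState, .readVars false)) .halt

variable [Finite I] [Finite E]

/-- The rounding machine. -/
noncomputable def machine (P : RoundingProgram ρ ar E Γ₁) : OracleTM E (FormulaSym I) Γ₁ where
  tm :=
    { K := P.Stk
      kFin := have := P.solver.tm.kFin; Fintype.ofFinite _
      k₀ := .inl .inp
      k₁ := .inl .out
      Γ := P.Alph
      Λ := P.Lbl
      main := .readVars false
      ΛFin := have := P.solver.tm.ΛFin; Fintype.ofFinite _
      σ := P.State
      initialState := (P.solver.tm.initialState, .readVars false)
      σFin := have := P.solver.tm.ΛFin; have := P.solver.tm.σFin; Fintype.ofFinite _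
      Γk₀Fin := Fintype.ofFinite (FormulaSym I)
      m := P.prog }
  inputAlphabet := Equiv.refl _
  outputAlphabet := Equiv.refl _
  queryStack := .inl .query
  queryAlphabet := Equiv.refl _
  ask := .ask
  resume := .answer

/-- The contents of the stacks. Numbers in unary are given by their values. -/
structure Stacks (P : RoundingProgram ρ ar E Γ₁) where
  inp : List (FormulaSym I) := []
  copy : List (FormulaSym I) := []
  count : Counter → ℕ := fun _ => 0
  tmp : ℕ := 0
  gen : List Sym := []
  word : List Bool := []
  query : List Bool := []
  ans : List E := []
  out : List Γ₁ := []
  solver : ∀ k, List (P.solver.tm.Γ k) := fun _ => []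

end RoundingProgram

namespace RoundingProgram

open Turing

variable {R : Type*} {ρ : BitRep R} {I : Type} {ar : I → ℕ} {E Γ₁ : Type}

/-! ### Stack contents as a record -/

namespace Stacks

variable {P : RoundingProgram ρ ar E Γ₁}

/-- The contents of all stacks, as a configuration of the machine holds them. -/
def stk (S : Stacks P) : ∀ k, List (P.Alph k)
  | .inl .inp => S.inp
  | .inl .copy => S.copy
  | .inl (.count c) => List.replicate (S.count c) ()
  | .inl .tmp => List.replicate S.tmp ()
  | .inl .gen => S.gen
  | .inl .word => S.word
  | .inl .query => S.query
  | .inl .ans => S.ans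
  | .inl .out => S.out
  | .inr k => S.solver k

variable (S : Stacks P)

@[simp] theorem stk_inp : S.stk (.inl .inp) = S.inp := rfl
@[simp] theorem stk_copy : S.stk (.inl .copy) = S.copy := rfl
@[simp] theorem stk_count (c) : S.stk (.inl (.count c)) = List.replicate (S.count c) () := rfl
@[simp] theorem stk_tmp : S.stk (.inl .tmp) = List.replicate S.tmp () := rfl
@[simp] theorem stk_gen : S.stk (.inl .gen) = S.gen := rfl
@[simp] theorem stk_word : S.stk (.inl .word) = S.word := rfl
@[simp] theorem stk_query : S.stk (.inl .query) = S.query := rfl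
@[simp] theorem stk_ans : S.stk (.inl .ans) = S.ans := rfl
@[simp] theorem stk_out : S.stk (.inl .out) = S.out := rfl
@[simp] theorem stk_inr (k) : S.stk (.inr k) = S.solver k := rfl

theorem eq_replicate_unit (x : List Unit) : x = List.replicate x.length () :=
  List.eq_replicate_iff.2 ⟨rfl, fun _ _ => rfl⟩

-- These lemmas turn an update of the stack function into an update of a record field, so that
-- `simp` can execute statements symbolically.
@[simp] theorem update_inp (x : List (FormulaSym I)) :
    Function.update S.stk (.inl .inp) x = { S with inp := x }.stk := by
  funext k; rcases k with (_ | _) | _ <;> simp [Function.update, stk]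
@[simp] theorem update_copy (x : List (FormulaSym I)) :
    Function.update S.stk (.inl .copy) x = { S with copy := x }.stk := by
  funext k; rcases k with (_ | _) | _ <;> simp [Function.update, stk]
@[simp] theorem update_count (c : Counter) (x : List Unit) :
    Function.update S.stk (.inl (.count c)) x =
      { S with count := Function.update S.count c x.length }.stk := by
  funext k
  rcases k with (_ | _ | c' | _) | _ <;> simp [Function.update, stk]
  split_ifs with h
  · subst h; exact eq_replicate_unit x
  · rfl
@[simp] theorem update_tmp (x : List Unit) :
    Function.update S.stk (.inl .tmp) x = { S with tmp := x.length }.stk := by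
  funext k; rcases k with (_ | _) | _ <;> simp [Function.update, stk, ← eq_replicate_unit]
@[simp] theorem update_gen (x : List Sym) :
    Function.update S.stk (.inl .gen) x = { S with gen := x }.stk := by
  funext k; rcases k with (_ | _) | _ <;> simp [Function.update, stk]
@[simp] theorem update_word (x : List Bool) :
    Function.update S.stk (.inl .word) x = { S with word := x }.stk := by
  funext k; rcases k with (_ | _) | _ <;> simp [Function.update, stk]
@[simp] theorem update_query (x : List Bool) :
    Function.update S.stk (.inl .query) x = { S with query := x }.stk := by
  funext k; rcases k with (_ | _) | _ <;> simp [Function.update, stk]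
@[simp] theorem update_ans (x : List E) :
    Function.update S.stk (.inl .ans) x = { S with ans := x }.stk := by
  funext k; rcases k with (_ | _) | _ <;> simp [Function.update, stk]
@[simp] theorem update_out (x : List Γ₁) :
    Function.update S.stk (.inl .out) x = { S with out := x }.stk := by
  funext k; rcases k with (_ | _) | _ <;> simp [Function.update, stk]
@[simp] theorem update_inr (k) (x : List (P.solver.tm.Γ k)) :
    Function.update S.stk (.inr k) x = { S with solver := Function.update S.solver k x }.stk := by
  funext k'
  rcases k' with (_ | _) | k'
  case inr => rcases eq_or_ne k' k with rfl | h <;> simp [stk, *]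
  all_goals simp [Function.update, stk]

end Stacks

/-- `n` zero coefficients. -/
def zeroWords (P : RoundingProgram ρ ar E Γ₁) (n : ℕ) : List Sym :=
  (List.replicate n (wordOf P.zero)).flatten

theorem zeroWords_add (P : RoundingProgram ρ ar E Γ₁) (m n : ℕ) :
    P.zeroWords (m + n) = P.zeroWords m ++ P.zeroWords n := by
  simp only [zeroWords, List.replicate_add, List.flatten_append]

/-! ### Runs between labels -/

variable [Finite I] [Finite E] (P : RoundingProgram ρ ar E Γ₁) (O : List Bool → E)

/-- A step of the rounding machine. -/
noncomputable def step (c : TM2.Cfg P.Alph P.Lbl P.State) :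
    Option (TM2.Cfg P.Alph P.Lbl P.State) :=
  P.machine.step O c

theorem step_of_ne (l : P.Lbl) (hl : l ≠ .ask) (v : P.State) (S : ∀ k, List (P.Alph k)) :
    P.step O ⟨some l, v, S⟩ = some (TM2.stepAux (P.prog l) v S) :=
  if_neg fun h => hl (Option.some.inj h)

theorem step_ask (v : P.State) (S : ∀ k, List (P.Alph k)) :
    P.step O ⟨some .ask, v, S⟩ =
      some ⟨some (.answer (O ((S (.inl .query)).map id))), v,
        Function.update S (.inl .query) []⟩ :=
  if_pos rfl

/-- The configuration at the label `l`, while the solver is not running. -/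
def cfg (l : P.Lbl) (r : P.Lbl) (S : Stacks P) : TM2.Cfg P.Alph P.Lbl P.State :=
  ⟨some l, (P.solver.tm.initialState, r), S.stk⟩

/-- The machine gets from the label `l` with stacks `S` to `l'` with stacks `S'` in `t` steps. -/
def Runs (t : ℕ) (l : P.Lbl) (S : Stacks P) (l' : P.Lbl) (S' : Stacks P) : Prop :=
  -- The label register holds whatever the last `popGoto` left there and never matters at the start
  -- of a statement, so it is quantified away.
  ∀ r, ∃ r', RunsTo (P.step O) t (P.cfg l r S) (P.cfg l' r' S')

variable {P O}

theorem Runs.refl (l : P.Lbl) (S : Stacks P) : P.Runs O 0 l S l S := fun r => ⟨r, .refl _⟩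

theorem Runs.mono {t t' : ℕ} {l l' : P.Lbl} {S S' : Stacks P} (h : P.Runs O t l S l' S')
    (ht : t ≤ t') : P.Runs O t' l S l' S' :=
  fun r => let ⟨r', h'⟩ := h r; ⟨r', h'.mono ht⟩

theorem Runs.trans {t t' : ℕ} {l l' l'' : P.Lbl} {S S' S'' : Stacks P}
    (h : P.Runs O t l S l' S') (h' : P.Runs O t' l' S' l'' S'') :
    P.Runs O (t + t') l S l'' S'' := fun r =>
  let ⟨r', h₁⟩ := h r
  let ⟨r'', h₂⟩ := h' r'
  ⟨r'', h₁.trans h₂⟩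

theorem Runs.congr {t : ℕ} {l l' : P.Lbl} {S S' S'' : Stacks P} (h : P.Runs O t l S l' S')
    (e : S' = S'') : P.Runs O t l S l' S'' := e ▸ h

theorem Runs.single {l l' : P.Lbl} {S S' : Stacks P} (hl : l ≠ .ask)
    (h : ∀ r, ∃ r', TM2.stepAux (P.prog l) (P.solver.tm.initialState, r) S.stk =
      P.cfg l' r' S') : P.Runs O 1 l S l' S' := fun r =>
  let ⟨r', h'⟩ := h r
  ⟨r', .single ((P.step_of_ne O l hl _ _).trans (congrArg some h'))⟩

/-- The induction step of all loops below: one step of the machine, the induction hypothesis, and an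
identification `e` of the final stacks. -/
theorem Runs.head {t : ℕ} {l l' l'' : P.Lbl} {S S'' : Stacks P} (S₁ : Stacks P) {S₂ : Stacks P}
    (hl : l ≠ .ask)
    (h : ∀ r, ∃ r', TM2.stepAux (P.prog l) (P.solver.tm.initialState, r) S.stk = P.cfg l' r' S₁)
    (h' : P.Runs O t l' S₁ l'' S₂) (e : S₂ = S'') : P.Runs O (t + 1) l S l'' S'' := by
  rw [add_comm, ← e]
  exact (Runs.single hl h).trans h'

/-! ### Loops -/

section Loops

variable (S : Stacks P)

/-- The induction generalizes over the pending tick `e`, which accounts for `e.toNat` in the result;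
the other loops treat their pending letters likewise. -/
theorem runs_readVars (k : ℕ) (e : Bool) (l)
    (h : S.inp = List.replicate k .tick ++ .endMark :: l) :
    P.Runs O (k + 1) (.readVars e) S (.readClauses none)
      { S with inp := l, count := Function.update S.count .vars (S.count .vars + e.toNat + k),
               gen := List.replicate (e.toNat + k) (Sym.bit false) ++ S.gen } := by
  induction k generalizing S e with
  | zero =>
    refine .single nofun fun r => ⟨.readClauses none, ?_⟩
    rw [List.replicate_zero, List.nil_append] at h
    simp [prog, h, cfg, tick, add_comm]
  | succ k ih =>
    refine .head { S with inp := List.replicate k .tick ++ .endMark :: l,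
                          count := Function.update S.count .vars (S.count .vars + e.toNat),
                          gen := List.replicate e.toNat (Sym.bit false) ++ S.gen }
      nofun (fun r => ⟨.readVars true, ?_⟩) (ih _ true rfl) ?_
    · simp [prog, h, cfg, tick, List.replicate_succ, add_comm]
    · simp [add_assoc, add_comm, ← List.append_assoc]

theorem runs_readClauses (l : List (FormulaSym I)) (o) (h : S.inp = l) :
    P.Runs O (l.length + 1) (.readClauses o) S (.restore none)
      { S with inp := [], copy := (o.toList ++ l).reverse ++ S.copy,
               count := Function.update S.count .after
                (S.count .after + ((o.toList ++ l).map P.symSize).sum),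
               gen := List.replicate ((o.toList ++ l).map P.symSize).sum (Sym.bit true) ++
                S.gen } := by
  induction l generalizing S o with
  | nil =>
    refine .single nofun fun r => ⟨.restore none, ?_⟩
    simp [prog, h, cfg, tick, add_comm]
  | cons a l ih =>
    refine .head { S with inp := l, copy := o.toList.reverse ++ S.copy
                          count := Function.update S.count .after
                            (S.count .after + (o.toList.map P.symSize).sum),
                          gen := List.replicate (o.toList.map P.symSize).sum (Sym.bit true) ++
                            S.gen }
      nofun (fun r => ⟨.readClauses (some a), ?_⟩) (ih _ (some a) rfl) ?_
    · simp [prog, h, cfg, tick, add_comm]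
    · simp [add_assoc, ← List.append_assoc, add_comm, add_left_comm]

theorem runs_restore (l : List (FormulaSym I)) (o) (h : S.copy = l) :
    P.Runs O (l.length + 1) (.restore o) S .separator
      { S with copy := [], inp := l.reverse ++ o.toList ++ S.inp } := by
  induction l generalizing S o with
  | nil =>
    refine .single nofun fun r => ⟨.separator, ?_⟩
    cases o <;> simp [prog, h, cfg]
  | cons a l ih =>
    refine .head { S with copy := l, inp := o.toList ++ S.inp }
      nofun (fun r => ⟨.restore (some a), ?_⟩) (ih _ (some a) rfl) ?_
    · cases o <;> simp [prog, h, cfg]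
    · simp

theorem runs_zeros_recount (c : Counter) (r : Row ar) (n : ℕ) (e : Bool) (h : S.count c = n) :
    P.Runs O (n + 1) (.zeros c r e) S (.recount c r false)
      { S with count := Function.update S.count c 0, tmp := S.tmp + e.toNat + n,
               gen := (P.zeroWords (e.toNat + n)).reverse ++ S.gen } := by
  induction n generalizing S e with
  | zero =>
    refine .single nofun fun r' => ⟨.recount c r false, ?_⟩
    simp [prog, h, cfg, untick, zeroWords, add_comm]
  | succ n ih =>
    refine .head { S with count := Function.update S.count c n, tmp := S.tmp + e.toNat,
                          gen := (P.zeroWords e.toNat).reverse ++ S.gen }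
      nofun (fun r' => ⟨.zeros c r true, ?_⟩) (ih _ true (by simp)) ?_
    · simp [prog, h, cfg, untick, zeroWords, List.replicate_succ, add_comm]
    · simp [zeroWords_add, add_assoc, add_comm n]

theorem runs_recount (c : Counter) (r : Row ar) (n : ℕ) (e : Bool) (h : S.tmp = n) :
    P.Runs O (n + 1) (.recount c r e) S (P.afterZeros c r)
      { S with count := Function.update S.count c (S.count c + e.toNat + n), tmp := 0 } := by
  induction n generalizing S e with
  | zero =>
    refine .single nofun fun r' => ⟨P.afterZeros c r, ?_⟩
    simp [prog, h, cfg, tick, add_comm]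
  | succ n ih =>
    refine .head { S with count := Function.update S.count c (S.count c + e.toNat), tmp := n }
      nofun (fun r' => ⟨.recount c r true, ?_⟩) (ih _ true rfl) ?_
    · simp [prog, h, cfg, tick, List.replicate_succ, add_comm]
    · simp [add_assoc, add_comm n]

/-- Ticks that lie on `tmp` beforehand join the counter without producing zeros. This is how `vars`
regains the ticks removed for an index. -/
theorem runs_zeros (c : Counter) (r : Row ar) :
    P.Runs O (2 * S.count c + S.tmp + 2) (.zeros c r false) S (P.afterZeros c r)
      { S with count := Function.update S.count c (S.count c + S.tmp), tmp := 0,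
               gen := (P.zeroWords (S.count c)).reverse ++ S.gen } := by
  have h := (runs_zeros_recount (O := O) S c r _ false rfl).trans (runs_recount _ c r _ false rfl)
  refine (h.mono (by simp; omega)).congr ?_
  simp [add_comm]

theorem runs_index (r : Σ i, Fin (ar i)) (k : ℕ) (e : Bool) (l)
    (h : S.inp = List.replicate k .tick ++ .endMark :: l) :
    P.Runs O (k + 1) (.index r e) S (.entry r)
      { S with inp := l,
               count := Function.update S.count .vars (S.count .vars - (e.toNat + k)),
               tmp := S.tmp + e.toNat + k,
               gen := (P.zeroWords (e.toNat + k)).reverse ++ S.gen } := by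
  induction k generalizing S e with
  | zero =>
    refine .single nofun fun r' => ⟨.entry r, ?_⟩
    rw [List.replicate_zero, List.nil_append] at h
    simp [prog, h, cfg, zeroWords, add_comm]
  | succ k ih =>
    refine .head { S with inp := List.replicate k .tick ++ .endMark :: l,
                          count := Function.update S.count .vars (S.count .vars - e.toNat),
                          tmp := S.tmp + e.toNat
                          gen := (P.zeroWords e.toNat).reverse ++ S.gen }
      nofun (fun r' => ⟨.index r true, ?_⟩) (ih _ true rfl) ?_
    · simp [prog, h, cfg, zeroWords, List.replicate_succ, add_comm]
    · simp [zeroWords_add, add_assoc, add_comm k, Nat.sub_sub]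

theorem runs_feed (l : List Sym) (o : Option Sym) (h : S.gen = l) :
    P.Runs O (l.length + 1) (.feed o) S (.run P.solver.tm.main)
      { S with gen := [],
               solver := Function.update S.solver P.solver.tm.k₀
                ((l.reverse ++ o.toList).map P.solver.inputAlphabet.invFun ++
                  S.solver P.solver.tm.k₀) } := by
  induction l generalizing S o with
  | nil =>
    refine .single nofun fun r => ⟨.run P.solver.tm.main, ?_⟩
    cases o <;> simp [prog, h, cfg]
  | cons a l ih =>
    refine .head { S with gen := l,
                          solver := Function.update S.solver P.solver.tm.k₀
                            (o.toList.map P.solver.inputAlphabet.invFun ++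
                              S.solver P.solver.tm.k₀) }
      nofun (fun r => ⟨.feed (some a), ?_⟩) (ih _ (some a) rfl) ?_
    · cases o <;> simp [prog, h, cfg]
    · simp

theorem runs_readWord (l : List Bool) (o : Option Bool) (s)
    (h : S.solver P.solver.tm.k₁ = (encodeWord l).map P.solver.outputAlphabet.invFun ++ s) :
    P.Runs O (l.length + 1) (.readWord o) S (.turn none)
      { S with word := (o.toList ++ l).reverse ++ S.word,
               solver := Function.update S.solver P.solver.tm.k₁ s } := by
  induction l generalizing S o with
  | nil =>
    refine .single nofun fun r => ⟨.turn none, ?_⟩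
    simp [encodeWord] at h
    cases o <;> simp [prog, h, cfg]
  | cons a l ih =>
    refine .head { S with word := o.toList ++ S.word,
                          solver := Function.update S.solver P.solver.tm.k₁
                            ((encodeWord l).map P.solver.outputAlphabet.invFun ++ s) }
      nofun (fun r => ⟨.readWord (some a), ?_⟩) (ih _ (some a) (by simp)) ?_
    · simp only [encodeWord, List.map_cons, List.cons_append] at h
      cases o <;> simp [prog, h, cfg, encodeWord]
    · cases o <;> simp

theorem runs_turn (l : List Bool) (o : Option Bool) (h : S.word = l) :
    P.Runs O (l.length + 1) (.turn o) S .ask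
      { S with word := [], query := l.reverse ++ o.toList ++ S.query } := by
  induction l generalizing S o with
  | nil =>
    refine .single nofun fun r => ⟨.ask, ?_⟩
    cases o <;> simp [prog, h, cfg]
  | cons a l ih =>
    refine .head { S with word := l, query := o.toList ++ S.query }
      nofun (fun r => ⟨.turn (some a), ?_⟩) (ih _ (some a) rfl) ?_
    · cases o <;> simp [prog, h, cfg]
    · simp

theorem runs_ask : P.Runs O 1 .ask S (.answer (O S.query)) { S with query := [] } :=
  fun r => ⟨r, .single ((P.step_ask O _ _).trans (by simp [cfg]))⟩

theorem runs_clearSolution (l) (h : S.solver P.solver.tm.k₁ = l) :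
    P.Runs O (l.length + 1) .clearSolution S .clearVars
      { S with solver := Function.update S.solver P.solver.tm.k₁ [] } := by
  induction l generalizing S with
  | nil =>
    refine .single nofun fun r => ⟨.clearVars, ?_⟩
    simp [prog, h, cfg]
  | cons a l ih =>
    refine .head { S with solver := Function.update S.solver P.solver.tm.k₁ l }
      nofun (fun r => ⟨.clearSolution, ?_⟩) (ih _ (by simp)) ?_
    · simp [prog, h, cfg]
    · simp

theorem runs_clearVars (n : ℕ) (h : S.count .vars = n) :
    P.Runs O (n + 1) .clearVars S .clearBefore
      { S with count := Function.update S.count .vars 0 } := by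
  induction n generalizing S with
  | zero =>
    refine .single nofun fun r => ⟨.clearBefore, ?_⟩
    simp [prog, h, cfg, untick]
  | succ n ih =>
    refine .head { S with count := Function.update S.count .vars n }
      nofun (fun r => ⟨.clearVars, ?_⟩) (ih _ (by simp)) ?_
    · simp [prog, h, cfg, untick, List.replicate_succ]
    · simp

theorem runs_clearBefore (n : ℕ) (h : S.count .before = n) :
    P.Runs O (n + 1) .clearBefore S (.output none)
      { S with count := Function.update S.count .before 0 } := by
  induction n generalizing S with
  | zero =>
    refine .single nofun fun r => ⟨.output none, ?_⟩
    simp [prog, h, cfg, untick]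
  | succ n ih =>
    refine .head { S with count := Function.update S.count .before n }
      nofun (fun r => ⟨.clearBefore, ?_⟩) (ih _ (by simp)) ?_
    · simp [prog, h, cfg, untick, List.replicate_succ]
    · simp

theorem runs_output (l : List E) (o : Option E) (h : S.ans = l) :
    P.Runs O (l.length + 1) (.output o) S .final
      { S with ans := [], out := (l.reverse ++ o.toList).flatMap P.emit ++ S.out } := by
  induction l generalizing S o with
  | nil =>
    refine .single nofun fun r => ⟨.final, ?_⟩
    cases o <;> simp [prog, h, cfg]
  | cons a l ih =>
    refine .head { S with ans := l, out := o.toList.flatMap P.emit ++ S.out }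
      nofun (fun r => ⟨.output (some a), ?_⟩) (ih _ (some a) rfl) ?_
    · cases o <;> simp [prog, h, cfg]
    · simp

end Loops

end RoundingProgram

namespace RoundingProgram

open Turing

variable {R : Type*} {ρ : BitRep R} {I : Type} {ar : I → ℕ} {E Γ₁ : Type}

/-! ### The equations -/

/-- The coefficients of the variables of the formula in an equation, where one of them may have the
coefficient `-1`. -/
def varCoeff (P : RoundingProgram ρ ar E Γ₁) (n : ℕ) : Option ℕ → List ρ.IsCode
  | none => List.replicate n P.zero
  | some v => List.replicate v P.zero ++ P.negOne :: List.replicate (n - (v + 1)) P.zero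

/-- An equation for a clause with `a` unknowns before and `b` unknowns after its own ones, given by
its coefficients and its right-hand side. -/
def row (P : RoundingProgram ρ ar E Γ₁) (n a b : ℕ) (r : Row ar) (v : Option ℕ) :
    List ρ.IsCode × ρ.IsCode :=
  (P.varCoeff n v ++ List.replicate a P.zero ++ P.coeff r ++ List.replicate b P.zero, P.rhs r)

/-- The equations for a clause. -/
def clauseRows (P : RoundingProgram ρ ar E Γ₁) (n a b : ℕ) (c : Σ i : I, Fin (ar i) → Fin n) :
    List (List ρ.IsCode × ρ.IsCode) :=
  P.row n a b ⟨c.1, none⟩ none ::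
    List.ofFn fun j => P.row n a b ⟨c.1, some j⟩ (some (c.2 j).val)

/-- The number of unknowns for a list of clauses. -/
def totalSize (P : RoundingProgram ρ ar E Γ₁) {n : ℕ}
    (cs : List (Σ i : I, Fin (ar i) → Fin n)) : ℕ :=
  (cs.map fun c => P.size c.1).sum

/-- The equations for a list of clauses with `a` unknowns before their own ones. -/
def rows (P : RoundingProgram ρ ar E Γ₁) (n : ℕ) :
    ℕ → List (Σ i : I, Fin (ar i) → Fin n) → List (List ρ.IsCode × ρ.IsCode)
  | _, [] => []
  | a, c :: cs => P.clauseRows n a (P.totalSize cs) c ++ P.rows n (a + P.size c.1) cs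

/-- An equation is written as its coefficients and its right-hand side. -/
def encodeRow (r : List ρ.IsCode × ρ.IsCode) : List Sym :=
  r.1.flatMap wordOf ++ wordOf r.2 ++ [Sym.semicolon]

/-- The system for a formula. -/
def systemString (P : RoundingProgram ρ ar E Γ₁) (Ψ : Formula ar) : List Sym :=
  List.replicate Ψ.n (Sym.bit false) ++ List.replicate (P.totalSize Ψ.clauses) (Sym.bit true) ++
    [Sym.semicolon] ++ (P.rows Ψ.n 0 Ψ.clauses).flatMap encodeRow

/-- The word for a clause. -/
def encodeClause {n : ℕ} (c : Σ i : I, Fin (ar i) → Fin n) : List (FormulaSym I) :=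
  FormulaSym.rel c.1 :: (List.ofFn c.2).flatMap fun v => encodeIndex v.val

/-- `LinSystem.encode` and `encodeSolution` coerce a whole list of codes to a list of words, which
is where the monadic bind comes from. -/
theorem flatMap_encodeWord_coe (l : List ρ.IsCode) :
    (l >>= fun a => pure (a : List Bool)).flatMap encodeWord = l.flatMap wordOf := by
  induction l with
  | nil => rfl
  | cons a l => simp [wordOf]

theorem flatMap_replicate_wordOf (P : RoundingProgram ρ ar E Γ₁) (n : ℕ) :
    (List.replicate n P.zero).flatMap wordOf = P.zeroWords n := by
  simp [List.flatMap, zeroWords]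

/-- Only relation symbols count, so the pass over the single letters finds the number of restricted
unknowns without parsing the clauses. -/
theorem sum_symSize_encodeClause (P : RoundingProgram ρ ar E Γ₁) {n : ℕ}
    (cs : List (Σ i : I, Fin (ar i) → Fin n)) :
    ((cs.flatMap encodeClause).map P.symSize).sum = P.totalSize cs := by
  have aux : ∀ l : List (Fin n),
      ((l.flatMap fun v => encodeIndex v.val).map P.symSize).sum = 0 := by
    intro l
    induction l with
    | nil => rfl
    | cons v l ih =>
      rw [List.flatMap_cons, List.map_append, List.sum_append, ih]
      simp [encodeIndex, symSize]
  induction cs with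
  | nil => rfl
  | cons c cs ih =>
    rw [List.flatMap_cons, List.map_append, List.sum_append, ih, encodeClause, List.map_cons,
      List.sum_cons, aux]
    simp [totalSize, symSize]

/-- The values of the three counters. -/
def counts (n a b : ℕ) : Counter → ℕ
  | .vars => n
  | .before => a
  | .after => b

@[simp] theorem counts_vars (n a b : ℕ) : counts n a b .vars = n := rfl
@[simp] theorem counts_before (n a b : ℕ) : counts n a b .before = a := rfl
@[simp] theorem counts_after (n a b : ℕ) : counts n a b .after = b := rfl
@[simp] theorem update_counts_vars (n a b x : ℕ) :
    Function.update (counts n a b) .vars x = counts x a b := by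
  funext c; cases c <;> simp
@[simp] theorem update_counts_before (n a b x : ℕ) :
    Function.update (counts n a b) .before x = counts n x b := by
  funext c; cases c <;> simp
@[simp] theorem update_counts_after (n a b x : ℕ) :
    Function.update (counts n a b) .after x = counts n a x := by
  funext c; cases c <;> simp

variable [Finite I] [Finite E] {P : RoundingProgram ρ ar E Γ₁} {O : List Bool → E}

/-! ### Writing the system of equations -/

section Clauses

variable (S : Stacks P)

/-- The common end of all equations. Here `d` is the number of own unknowns still contained in
`after` (nonzero only for the normalizing equation), and `S.tmp` is the part of `vars` whose
coefficients are already written. -/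
theorem runs_const (r : Row ar) (n a d b : ℕ)
    (hd : (r.2.elim (P.size r.1) fun _ => 0) = d) (h : S.count = counts n a (d + b)) :
    P.Runs O (2 * n + S.tmp + 2 * a + 2 * b + 8) (.zeros .vars r false) S (P.nextLabel r)
      { S with count := counts (n + S.tmp) a b, tmp := 0,
               gen := (P.zeroWords n ++ P.zeroWords a ++ (P.coeff r).flatMap wordOf ++
                P.zeroWords b ++ wordOf (P.rhs r) ++ [Sym.semicolon]).reverse ++ S.gen } := by
  have h₁ := runs_zeros (O := O) S .vars r
  have h₂ := runs_zeros (O := O) { S with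
    count := counts (n + S.tmp) a (d + b), tmp := 0,
    gen := (P.zeroWords n).reverse ++ S.gen } .before r
  have h₃ : P.Runs O 1 (.block r) { S with
      count := counts (n + S.tmp) a (d + b), tmp := 0,
      gen := (P.zeroWords n ++ P.zeroWords a).reverse ++ S.gen } (.zeros .after r false)
      { S with
        count := counts (n + S.tmp) a b, tmp := 0,
        gen := (P.zeroWords n ++ P.zeroWords a ++ (P.coeff r).flatMap wordOf).reverse ++ S.gen } :=
    .single nofun fun r' => ⟨r', by simp [prog, cfg, hd]⟩
  have h₄ := runs_zeros (O := O) { S with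
    count := counts (n + S.tmp) a b, tmp := 0,
    gen := (P.zeroWords n ++ P.zeroWords a ++ (P.coeff r).flatMap wordOf).reverse ++ S.gen }
    .after r
  have h₅ : P.Runs O 1 (.const r) { S with
      count := counts (n + S.tmp) a b, tmp := 0,
      gen := (P.zeroWords n ++ P.zeroWords a ++ (P.coeff r).flatMap wordOf ++
        P.zeroWords b).reverse ++ S.gen } (P.nextLabel r) { S with
      count := counts (n + S.tmp) a b, tmp := 0,
      gen := (P.zeroWords n ++ P.zeroWords a ++ (P.coeff r).flatMap wordOf ++
        P.zeroWords b ++ wordOf (P.rhs r) ++ [Sym.semicolon]).reverse ++ S.gen } :=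
    .single nofun fun r' => ⟨r', by simp [prog, cfg]⟩
  have h₁' := h₁.congr (S'' := { S with
    count := counts (n + S.tmp) a (d + b), tmp := 0,
    gen := (P.zeroWords n).reverse ++ S.gen }) (by simp [h])
  have h₂' := h₂.congr (S'' := { S with
      count := counts (n + S.tmp) a (d + b), tmp := 0,
      gen := (P.zeroWords n ++ P.zeroWords a).reverse ++ S.gen }) (by simp)
  have h₄' := h₄.congr (S'' := { S with
      count := counts (n + S.tmp) a b, tmp := 0,
      gen := (P.zeroWords n ++ P.zeroWords a ++ (P.coeff r).flatMap wordOf ++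
        P.zeroWords b).reverse ++ S.gen }) (by simp)
  refine ((((h₁'.trans h₂').trans h₃).trans h₄').trans h₅).mono ?_
  simp [h]
  omega

theorem runs_row (i : I) (j : Fin (ar i)) (v n a b : ℕ) (l) (hv : v < n)
    (h : S.count = counts n a b) (ht : S.tmp = 0) (hl : S.inp = encodeIndex v ++ l) :
    P.Runs O (2 * (n + a + b) + 10) (P.rowLabel i j) S (P.rowLabel i (j + 1))
      { S with inp := l,
               gen := (encodeRow (P.row n a b ⟨i, some j⟩ (some v))).reverse ++ S.gen } := by
  have e : P.rowLabel i j = .index ⟨i, j⟩ false := by simp [rowLabel]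
  have h₁ := runs_index (O := O) S ⟨i, j⟩ v false l (by simpa [encodeIndex] using hl)
  have h₂ : P.Runs O 1 (.entry ⟨i, j⟩) { S with
      inp := l, count := counts (n - v) a b, tmp := v, gen := (P.zeroWords v).reverse ++ S.gen }
      (.zeros .vars ⟨i, some j⟩ false) { S with
      inp := l, count := counts (n - (v + 1)) a b, tmp := v + 1,
      gen := (P.zeroWords v ++ wordOf P.negOne).reverse ++ S.gen } :=
    .single nofun fun r => ⟨r, by simp [prog, cfg, Nat.sub_sub]⟩
  have h₃ := runs_const (O := O) { S with
      inp := l, count := counts (n - (v + 1)) a b, tmp := v + 1,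
      gen := (P.zeroWords v ++ wordOf P.negOne).reverse ++ S.gen } ⟨i, some j⟩ (n - (v + 1)) a 0 b
      rfl (by simp)
  rw [e]
  refine (((h₁.congr ?_).trans h₂).trans h₃).mono ?_ |>.congr ?_
  · simp [h, ht]
  · simp; omega
  · have : n - (v + 1) + (v + 1) = n := by omega
    simp [encodeRow, row, varCoeff, flatMap_replicate_wordOf, zeroWords_add, this, h, ht]

/-- The induction is on the number `m` of coordinates left, while `j` moves forward. The last jump
of `rowLabel` leaves the loop. -/
theorem runs_rows (i : I) (n a b : ℕ) (v : Fin (ar i) → Fin n) (l) (m j : ℕ)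
    (hj : j + m = ar i) (h : S.count = counts n a b) (ht : S.tmp = 0)
    (hl : S.inp = ((List.ofFn v).drop j).flatMap (fun v => encodeIndex v.val) ++ l) :
    P.Runs O (m * (2 * (n + a + b) + 10)) (P.rowLabel i j) S (.close i)
      { S with inp := l,
               gen := (((List.ofFn fun j =>
                P.row n a b ⟨i, some j⟩ (some (v j).val)).drop j).flatMap encodeRow).reverse ++
                S.gen } := by
  induction m generalizing S j with
  | zero =>
    have e : P.rowLabel i j = .close i := by simp [rowLabel, show ¬ j < ar i by omega]
    rw [e, List.drop_eq_nil_of_le (by simp; omega)]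
    rw [List.drop_eq_nil_of_le (by simp; omega)] at hl
    refine ((Runs.refl _ _).mono (by omega)).congr ?_
    simp at hl
    simp [← hl]
  | succ m ih =>
    have hj' : j < ar i := by omega
    rw [List.drop_eq_getElem_cons (by simpa using hj')] at hl ⊢
    simp only [List.getElem_ofFn, List.flatMap_cons, List.append_assoc] at hl
    have h₁ := runs_row (O := O) S i ⟨j, hj'⟩ _ n a b _ (v ⟨j, hj'⟩).isLt h ht hl
    have h₂ := fun S => ih S (j + 1) (by omega)
    refine ((h₁.trans (h₂ _ h ht rfl)).mono (by rw [add_mul]; omega)).congr ?_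
    simp

theorem runs_clause (n a b : ℕ) (c : Σ i : I, Fin (ar i) → Fin n) (l)
    (h : S.count = counts n a (P.size c.1 + b)) (ht : S.tmp = 0)
    (hl : S.inp = encodeClause c ++ l) :
    P.Runs O ((ar c.1 + 1) * (2 * (n + a + b) + 10)) .clause S .clause
      { S with inp := l, count := counts n (a + P.size c.1) b,
               gen := ((P.clauseRows n a b c).flatMap encodeRow).reverse ++ S.gen } := by
  have h₁ : P.Runs O 1 .clause S (.zeros .vars ⟨c.1, none⟩ false)
      { S with inp := (List.ofFn c.2).flatMap (fun v => encodeIndex v.val) ++ l } :=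
    .single nofun fun r => ⟨.zeros .vars ⟨c.1, none⟩ false,
      by simp [prog, cfg, hl, encodeClause]⟩
  have h₂ := runs_const (O := O) { S with
    inp := (List.ofFn c.2).flatMap (fun v => encodeIndex v.val) ++ l } ⟨c.1, none⟩ n a _ b rfl h
  have h₃ := fun S => runs_rows (O := O) (P := P) S c.1 n a b c.2 l (ar c.1) 0 (by simp)
  have h₄ : ∀ S : Stacks P, S.count = counts n a b → P.Runs O 1 (.close c.1) S .clause
      { S with count := counts n (a + P.size c.1) b } := fun S hS =>
    .single nofun fun r => ⟨r, by simp [prog, cfg, hS, tick, add_comm]⟩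
  refine (((h₁.trans h₂).trans (h₃ _ ?_ ?_ ?_)).trans (h₄ _ ?_)).mono ?_ |>.congr ?_
  · simp [ht]
  · rfl
  · simp
  · simp [ht]
  · simp [ht, add_mul]; omega
  · simp [clauseRows, encodeRow, row, varCoeff, flatMap_replicate_wordOf, zeroWords_add, ht]

/-- The number of equations for a list of clauses. -/
def rowCount {n : ℕ} (cs : List (Σ i : I, Fin (ar i) → Fin n)) : ℕ :=
  (cs.map fun c => ar c.1 + 1).sum

/-- The sum `n + a + P.totalSize cs` does not change from clause to clause, as unknowns only move
from `after` to `before`; so one `N` bounds the cost of every equation. -/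
theorem runs_clauses (n a N : ℕ) (cs : List (Σ i : I, Fin (ar i) → Fin n))
    (h : S.count = counts n a (P.totalSize cs)) (ht : S.tmp = 0)
    (hl : S.inp = cs.flatMap encodeClause) (hN : n + a + P.totalSize cs ≤ N) :
    P.Runs O (rowCount cs * (2 * N + 10) + 1) .clause S (.feed none)
      { S with inp := [], count := counts n (a + P.totalSize cs) 0,
               gen := ((P.rows n a cs).flatMap encodeRow).reverse ++ S.gen } := by
  induction cs generalizing S a with
  | nil =>
    simp only [List.flatMap_nil] at hl
    have h₁ : P.Runs O 1 .clause S (.feed none) { S with inp := [] } :=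
      .single nofun fun r => ⟨.feed none, by simp [prog, cfg, hl]⟩
    refine (h₁.mono (Nat.le_add_left _ _)).congr ?_
    rw [totalSize, List.map_nil, List.sum_nil] at h
    simp [rows, totalSize, h]
  | cons c cs ih =>
    have e : P.totalSize (c :: cs) = P.size c.1 + P.totalSize cs := by simp [totalSize]
    rw [e] at h hN
    have h₁ := runs_clause (O := O) S n a (P.totalSize cs) c (cs.flatMap encodeClause) h ht
      (by simpa using hl)
    have h₂ := fun S hS => ih S (a + P.size c.1) hS
    refine ((h₁.trans (h₂ _ rfl ht rfl (by omega))).mono ?_).congr ?_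
    · have e' : rowCount (c :: cs) = (ar c.1 + 1) + rowCount cs := by simp [rowCount]
      rw [e', add_mul (ar c.1 + 1)]
      have : (ar c.1 + 1) * (2 * (n + a + P.totalSize cs) + 10) ≤ (ar c.1 + 1) * (2 * N + 10) :=
        Nat.mul_le_mul_left _ (by omega)
      omega
    · simp [rows, e, add_assoc]

/-- The machine translates a formula into a system of equations, and starts the solver. -/
theorem runs_generate (Ψ : Formula ar) :
    P.Runs O (4 * (encodeFormula Ψ).length + rowCount Ψ.clauses *
        (2 * (Ψ.n + P.totalSize Ψ.clauses) + 10) + (P.systemString Ψ).length + 10)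
      (.readVars false) { inp := encodeFormula Ψ } (.run P.solver.tm.main)
      { count := counts Ψ.n (P.totalSize Ψ.clauses) 0,
        solver := Function.update (fun _ => []) P.solver.tm.k₀
          ((P.systemString Ψ).map P.solver.inputAlphabet.invFun) } := by
  have e : encodeFormula Ψ = List.replicate Ψ.n .tick ++ .endMark ::
      Ψ.clauses.flatMap encodeClause := by
    simp [encodeFormula, encodeIndex]; rfl
  set L := (encodeFormula Ψ).length
  have hL : Ψ.n + (Ψ.clauses.flatMap encodeClause).length + 1 = L := by
    simp only [L, e]; simp; omega
  have h₁ := runs_readVars (O := O) (P := P) { inp := encodeFormula Ψ } Ψ.n false _ e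
  have h₂ := runs_readClauses (O := O) (P := P) {
      inp := Ψ.clauses.flatMap encodeClause,
      count := counts Ψ.n 0 0, gen := List.replicate Ψ.n (Sym.bit false) } _ none rfl
  have h₃ := runs_restore (O := O) (P := P) {
      copy := (Ψ.clauses.flatMap encodeClause).reverse,
      count := counts Ψ.n 0 (P.totalSize Ψ.clauses),
      gen := List.replicate (P.totalSize Ψ.clauses) (Sym.bit true) ++
        List.replicate Ψ.n (Sym.bit false) } _ none rfl
  have h₄ : P.Runs O 1 .separator {
      inp := Ψ.clauses.flatMap encodeClause,
      count := counts Ψ.n 0 (P.totalSize Ψ.clauses),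
      gen := List.replicate (P.totalSize Ψ.clauses) (Sym.bit true) ++
        List.replicate Ψ.n (Sym.bit false) } .clause {
      inp := Ψ.clauses.flatMap encodeClause,
      count := counts Ψ.n 0 (P.totalSize Ψ.clauses),
      gen := Sym.semicolon :: (List.replicate (P.totalSize Ψ.clauses) (Sym.bit true) ++
        List.replicate Ψ.n (Sym.bit false)) } :=
    .single nofun fun r => ⟨r, by simp [prog, cfg]⟩
  have h₅ := runs_clauses (O := O) (P := P) {
      inp := Ψ.clauses.flatMap encodeClause,
      count := counts Ψ.n 0 (P.totalSize Ψ.clauses),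
      gen := Sym.semicolon :: (List.replicate (P.totalSize Ψ.clauses) (Sym.bit true) ++
        List.replicate Ψ.n (Sym.bit false)) } Ψ.n 0 (Ψ.n + P.totalSize Ψ.clauses) Ψ.clauses rfl rfl
        rfl (by simp)
  have h₆ := runs_feed (O := O) (P := P) {
      count := counts Ψ.n (P.totalSize Ψ.clauses) 0,
      gen := (P.systemString Ψ).reverse } _ none rfl
  refine (((((h₁.congr ?_).trans (h₂.congr ?_)).trans ((h₃.congr ?_).trans h₄)).trans
    (h₅.congr ?_)).trans (h₆.congr ?_)).mono ?_
  · have : (fun _ => 0 : Counter → ℕ) = counts 0 0 0 := by funext c; cases c <;> rfl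
    simp [this]
  · simp [sum_symSize_encodeClause]
  · simp
  · simp [systemString]
  · simp
  · simp [-List.length_flatMap]; omega

end Clauses

end RoundingProgram

namespace RoundingProgram

open Turing

variable {R : Type*} {ρ : BitRep R} {I : Type} {ar : I → ℕ} {E Γ₁ : Type}

/-! ### The run of the solver -/

/-- The configuration of the rounding machine while the solver is running. -/
def solverCfg (P : RoundingProgram ρ ar E Γ₁) (S : Stacks P) (r : P.Lbl)
    (c : TM2.Cfg P.solver.tm.Γ P.solver.tm.Λ P.solver.tm.σ) : TM2.Cfg P.Alph P.Lbl P.State :=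
  ⟨some (c.l.elim .verdict .run), (c.var, r), { S with solver := c.stk }.stk⟩

theorem stepAux_lift (P : RoundingProgram ρ ar E Γ₁) (S : Stacks P) (r : P.Lbl)
    (q : TM2.Stmt P.solver.tm.Γ P.solver.tm.Λ P.solver.tm.σ) (v : P.solver.tm.σ)
    (T : ∀ k, List (P.solver.tm.Γ k)) :
    TM2.stepAux (P.lift q) (v, r) { S with solver := T }.stk =
      P.solverCfg S r (TM2.stepAux q v T) := by
  induction q generalizing v T with
  | push k f q ih => simpa [lift] using ih _ _
  | peek k f q ih => simpa [lift] using ih _ _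
  | pop k f q ih => simpa [lift] using ih _ _
  | load f q ih => simpa [lift] using ih _ _
  | branch f q₁ q₂ ih₁ ih₂ =>
    simp only [lift, TM2.stepAux]
    cases f v
    · exact ih₂ _ _
    · exact ih₁ _ _
  | goto f => rfl
  | halt => rfl

variable [Finite I] [Finite E] {P : RoundingProgram ρ ar E Γ₁} {O : List Bool → E}

/-- Each step of the solver is one step of the large machine, and its `halt` becomes a jump to
`verdict`. By the convention `haltList`, it returns in its initial state with only its output left
on its stacks. -/
theorem runs_solver (S : Stacks P) (l : List (P.solver.tm.Γ P.solver.tm.k₀))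
    (l' : List (P.solver.tm.Γ P.solver.tm.k₁)) (t : ℕ)
    (h : Nonempty (TM2OutputsInTime P.solver.tm l (some l') t)) :
    P.Runs O t (.run P.solver.tm.main)
      { S with solver := Function.update (fun _ => []) P.solver.tm.k₀ l } .verdict
      { S with solver := Function.update (fun _ => []) P.solver.tm.k₁ l' } := by
  obtain ⟨⟨⟨s, e⟩, hs⟩⟩ := h
  refine fun r => ⟨r, s, hs, ?_⟩
  have := iterate_bind_map (g := P.step O) (P.solverCfg S r) (fun a b hab => ?_) s _ _ e
  · rw [← initList_stk, ← haltList_stk]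
    exact this
  · obtain ⟨q, v, T⟩ := a
    cases q with
    | none => cases hab
    | some q =>
      obtain rfl : TM2.stepAux (P.solver.tm.m q) v T = b := Option.some.inj hab
      exact (P.step_of_ne O (.run q) nofun _ _).trans (congrArg some (P.stepAux_lift S r _ _ _))

/-! ### The output -/

/-- A word `w` costs `2 * w.length + 5` steps, at most 5 per letter when its end mark is counted.
The rest `s` holds the codes of the combination coefficients, which are not rounded. -/
theorem runs_nextVar (S : Stacks P) (ws : List (List Bool)) (s) (hw : S.word = [])
    (hq : S.query = []) (hv : S.count .vars = ws.length)
    (h : S.solver P.solver.tm.k₁ =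
      (ws.flatMap encodeWord).map P.solver.outputAlphabet.invFun ++ s) :
    P.Runs O (5 * (ws.flatMap encodeWord).length + 1) .nextVar S .clearSolution
      { S with count := Function.update S.count .vars 0, ans := (ws.map O).reverse ++ S.ans,
               solver := Function.update S.solver P.solver.tm.k₁ s } := by
  induction ws generalizing S with
  | nil =>
    simp at h hv
    refine .single nofun fun r => ⟨.clearSolution, ?_⟩
    have e₁ : Function.update S.count .vars 0 = S.count := by rw [← hv]; simp
    have e₂ : Function.update S.solver P.solver.tm.k₁ s = S.solver := by rw [← h]; simp
    simp [prog, cfg, untick, hv, e₁, e₂]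
  | cons w ws ih =>
    simp only [List.flatMap_cons, List.map_append, List.append_assoc] at h
    have h₁ : P.Runs O 1 .nextVar S (.readWord none)
        { S with count := Function.update S.count .vars ws.length } :=
      .single nofun fun r => ⟨.readWord none,
        by simp [prog, cfg, untick, hv, List.replicate_succ]⟩
    have h₂ := runs_readWord (O := O) { S with
      count := Function.update S.count .vars ws.length } w none _ h
    have h₃ := runs_turn (O := O) { S with
      count := Function.update S.count .vars ws.length, word := w.reverse,
      solver := Function.update S.solver P.solver.tm.k₁
        ((ws.flatMap encodeWord).map P.solver.outputAlphabet.invFun ++ s) } _ none rfl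
    have h₄ := runs_ask (O := O) { S with
      count := Function.update S.count .vars ws.length, query := w,
      solver := Function.update S.solver P.solver.tm.k₁
        ((ws.flatMap encodeWord).map P.solver.outputAlphabet.invFun ++ s) }
    have h₅ : P.Runs O 1 (.answer (O w)) { S with
        count := Function.update S.count .vars ws.length,
        solver := Function.update S.solver P.solver.tm.k₁
          ((ws.flatMap encodeWord).map P.solver.outputAlphabet.invFun ++ s) } .nextVar { S with
        count := Function.update S.count .vars ws.length, ans := O w :: S.ans,
        solver := Function.update S.solver P.solver.tm.k₁
          ((ws.flatMap encodeWord).map P.solver.outputAlphabet.invFun ++ s) } :=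
      .single nofun fun r => ⟨r, by simp [prog, cfg]⟩
    have h₆ := ih { S with
        count := Function.update S.count .vars ws.length, ans := O w :: S.ans,
        solver := Function.update S.solver P.solver.tm.k₁
          ((ws.flatMap encodeWord).map P.solver.outputAlphabet.invFun ++ s) } hw hq (by simp)
          (by simp)
    refine (((((h₁.trans (h₂.congr ?_)).trans (h₃.congr ?_)).trans (h₄.congr ?_)).trans h₅).trans
      h₆).mono ?_ |>.congr ?_
    · simp [hw]
    · simp [hw, hq]
    · simp [hq]
    · simp [encodeWord, -List.length_flatMap]; omega
    · simp

/-- A halting configuration must have all stacks but the output empty. Popping `ans` reverses the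
answers, so the first variable ends up on top. -/
theorem runs_clear (S : Stacks P) (n a : ℕ) (l) (h : S.count = counts n a 0)
    (hl : S.solver = Function.update (fun _ => []) P.solver.tm.k₁ l) :
    P.Runs O (n + a + l.length + S.ans.length + 4) .clearSolution S .final
      { S with count := fun _ => 0, ans := [], out := S.ans.reverse.flatMap P.emit ++ S.out,
               solver := fun _ => [] } := by
  have h₁ := runs_clearSolution (O := O) S l (by simp [hl])
  have h₂ := runs_clearVars (O := O) (P := P) { S with solver := fun _ => [] } n (by simp [h])
  have h₃ := runs_clearBefore (O := O) (P := P)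
    { S with count := counts 0 a 0, solver := fun _ => [] } a
    (by simp)
  have h₄ := runs_output (O := O) (P := P)
    { S with count := counts 0 0 0, solver := fun _ => [] } _ none rfl
  have e : counts 0 0 0 = fun _ => 0 := by funext c; cases c <;> rfl
  refine ((((h₁.congr ?_).trans (h₂.congr ?_)).trans (h₃.congr ?_)).trans h₄).mono ?_ |>.congr ?_
  · simp [hl]
  · simp [h]
  · simp
  · dsimp only; omega
  · simp [e]

theorem outputsInTime_of_runs (l : List (FormulaSym I)) (l' : List Γ₁) (t : ℕ)
    (h : P.Runs O t (.readVars false) { inp := l } .final { out := l' }) :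
    P.machine.OutputsInTime O l l' (t + 1) := by
  obtain ⟨r, h⟩ := h (.readVars false)
  have e : ({} : Stacks P).stk = fun _ => [] := by
    funext k; rcases k with (_ | _) | _ <;> rfl
  refine (h.trans (.single (b := Turing.haltList P.machine.tm (l'.map id)) ?_)).evalsToInTime.map
    fun h => ?_
  · refine (P.step_of_ne O .final nofun _ _).trans (congrArg some ?_)
    have := haltList_stk P.machine.tm (l'.map id)
    change (⟨_, _, _⟩ : TM2.Cfg P.Alph P.Lbl P.State) = ⟨_, _, _⟩
    congr 1
    refine Eq.trans ?_ this.symm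
    change _ = Function.update (fun _ => [] : ∀ k, List (P.Alph k)) (.inl .out) (l'.map id)
    rw [← e, Stacks.update_out]; simp
  · have e' : Turing.initList P.machine.tm (l.map id) = P.cfg (.readVars false) (.readVars false)
        { inp := l } := by
      have := initList_stk P.machine.tm (l.map id)
      change (⟨_, _, _⟩ : TM2.Cfg P.Alph P.Lbl P.State) = ⟨_, _, _⟩
      congr 1
      refine this.trans ?_
      change Function.update (fun _ => [] : ∀ k, List (P.Alph k)) (.inl .inp) (l.map id) = _
      rw [← e, Stacks.update_inp]; simp
    change StateTransition.EvalsToInTime _ (Turing.initList P.machine.tm (l.map id)) _ _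
    rw [e']
    exact h

/-- A bound for the number of steps before the solver starts. -/
def genTime (P : RoundingProgram ρ ar E Γ₁) (Ψ : Formula ar) : ℕ :=
  4 * (encodeFormula Ψ).length + rowCount Ψ.clauses *
    (2 * (Ψ.n + P.totalSize Ψ.clauses) + 10) + (P.systemString Ψ).length + 10

theorem outputsInTime_accept (Ψ : Formula ar) (ws : List (List Bool)) (t : ℕ)
    (hn : Ψ.n ≤ ws.length)
    (h : Nonempty (TM2OutputsInTime P.solver.tm
      ((P.systemString Ψ).map P.solver.inputAlphabet.invFun)
      (some ((Sym.bit true :: ws.flatMap encodeWord).map P.solver.outputAlphabet.invFun)) t)) :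
    P.machine.OutputsInTime O (encodeFormula Ψ)
      (((ws.take Ψ.n).map O).flatMap P.emit ++ P.accept)
      (P.genTime Ψ + t + 6 * (ws.flatMap encodeWord).length + Ψ.n +
        P.totalSize Ψ.clauses + 8) := by
  have h₁ := runs_generate (O := O) (P := P) Ψ
  have h₂ := runs_solver (O := O) { count := counts Ψ.n (P.totalSize Ψ.clauses) 0 } _ _ t h
  have h₃ : P.Runs O 1 .verdict {
      count := counts Ψ.n (P.totalSize Ψ.clauses) 0,
      solver := Function.update (fun _ => []) P.solver.tm.k₁
        ((Sym.bit true :: ws.flatMap encodeWord).map P.solver.outputAlphabet.invFun) } .accepted {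
      count := counts Ψ.n (P.totalSize Ψ.clauses) 0,
      solver := Function.update (fun _ => []) P.solver.tm.k₁
        ((ws.flatMap encodeWord).map P.solver.outputAlphabet.invFun) } :=
    .single nofun fun r => ⟨.accepted, by simp [prog, cfg]⟩
  have h₄ : P.Runs O 1 .accepted {
      count := counts Ψ.n (P.totalSize Ψ.clauses) 0,
      solver := Function.update (fun _ => []) P.solver.tm.k₁
        ((ws.flatMap encodeWord).map P.solver.outputAlphabet.invFun) } .nextVar {
      count := counts Ψ.n (P.totalSize Ψ.clauses) 0, out := P.accept,
      solver := Function.update (fun _ => []) P.solver.tm.k₁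
        ((ws.flatMap encodeWord).map P.solver.outputAlphabet.invFun) } :=
    .single nofun fun r => ⟨r, by simp [prog, cfg]⟩
  -- The values of the variables precede the coefficients; only the former are passed to the oracle.
  have e : ws.flatMap encodeWord =
      (ws.take Ψ.n).flatMap encodeWord ++ (ws.drop Ψ.n).flatMap encodeWord := by
    rw [← List.flatMap_append, List.take_append_drop]
  have h₅ := runs_nextVar (O := O) (P := P) {
      count := counts Ψ.n (P.totalSize Ψ.clauses) 0, out := P.accept,
      solver := Function.update (fun _ => []) P.solver.tm.k₁
        ((ws.flatMap encodeWord).map P.solver.outputAlphabet.invFun) } (ws.take Ψ.n)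
      (((ws.drop Ψ.n).flatMap encodeWord).map P.solver.outputAlphabet.invFun) rfl rfl
      (by simpa using hn) 
      (by dsimp only; rw [Function.update_self, e, List.map_append])
  have h₆ := runs_clear (O := O) (P := P) {
      count := counts 0 (P.totalSize Ψ.clauses) 0, out := P.accept,
      ans := ((ws.take Ψ.n).map O).reverse,
      solver := Function.update (fun _ => []) P.solver.tm.k₁
        (((ws.drop Ψ.n).flatMap encodeWord).map P.solver.outputAlphabet.invFun) } _ _ _ rfl rfl
  have := (((((h₁.trans h₂).trans h₃).trans h₄).trans (h₅.congr (by simp))).trans h₆).congr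
    (S'' := { out := ((ws.take Ψ.n).map O).flatMap P.emit ++ P.accept }) (by simp)
  obtain ⟨h⟩ := outputsInTime_of_runs _ _ _ this
  refine ⟨⟨h.toEvalsTo, h.steps_le_m.trans ?_⟩⟩
  have e' := congrArg List.length e
  simp [-List.length_flatMap, genTime, hn] at e' ⊢
  omega

theorem outputsInTime_reject (Ψ : Formula ar) (t : ℕ)
    (h : Nonempty (TM2OutputsInTime P.solver.tm
      ((P.systemString Ψ).map P.solver.inputAlphabet.invFun)
      (some ([Sym.bit false].map P.solver.outputAlphabet.invFun)) t)) :
    P.machine.OutputsInTime O (encodeFormula Ψ) P.reject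
      (P.genTime Ψ + t + Ψ.n + P.totalSize Ψ.clauses + 8) := by
  have h₁ := runs_generate (O := O) (P := P) Ψ
  have h₂ := runs_solver (O := O) { count := counts Ψ.n (P.totalSize Ψ.clauses) 0 } _ _ t h
  have h₃ : P.Runs O 1 .verdict {
      count := counts Ψ.n (P.totalSize Ψ.clauses) 0,
      solver := Function.update (fun _ => []) P.solver.tm.k₁
        ([Sym.bit false].map P.solver.outputAlphabet.invFun) } .rejected {
      count := counts Ψ.n (P.totalSize Ψ.clauses) 0,
      solver := Function.update (fun _ => []) P.solver.tm.k₁ [] } :=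
    .single nofun fun r => ⟨.rejected, by simp [prog, cfg]⟩
  have h₄ : P.Runs O 1 .rejected {
      count := counts Ψ.n (P.totalSize Ψ.clauses) 0,
      solver := Function.update (fun _ => []) P.solver.tm.k₁ [] } .clearSolution {
      count := counts Ψ.n (P.totalSize Ψ.clauses) 0, out := P.reject,
      solver := Function.update (fun _ => []) P.solver.tm.k₁ [] } :=
    .single nofun fun r => ⟨r, by simp [prog, cfg]⟩
  have h₅ := runs_clear (O := O) (P := P) {
      count := counts Ψ.n (P.totalSize Ψ.clauses) 0, out := P.reject,
      solver := Function.update (fun _ => []) P.solver.tm.k₁ [] } _ _ _ rfl rfl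
  have := ((((h₁.trans h₂).trans h₃).trans h₄).trans h₅).congr
    (S'' := { out := P.reject }) (by simp)
  obtain ⟨h⟩ := outputsInTime_of_runs _ _ _ this
  refine ⟨⟨h.toEvalsTo, h.steps_le_m.trans ?_⟩⟩
  simp [genTime]
  omega

end RoundingProgram

/-! ## The system of equations of a formula -/

section Dot

variable {R : Type*} [CommRing R] {ρ : BitRep R}

/-- The left-hand side of an equation with the given coefficients. -/
def dot (ρ : BitRep R) (l : List ρ.IsCode) (x : List R) : R :=
  (List.zipWith (fun a y => ρ.val a * y) l x).sum

theorem dot_append {l l' : List ρ.IsCode} {x x' : List R} (h : l.length = x.length) :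
    dot ρ (l ++ l') (x ++ x') = dot ρ l x + dot ρ l' x' := by
  rw [dot, List.zipWith_append h, List.sum_append]; rfl

theorem dot_cons (a : ρ.IsCode) (l : List ρ.IsCode) (y : R) (x : List R) :
    dot ρ (a :: l) (y :: x) = ρ.val a * y + dot ρ l x := by
  simp [dot]

/-- The length of `x` is free because `zipWith` truncates; this covers the unknowns of later
clauses. -/
theorem dot_replicate_zero {z : ρ.IsCode} (hz : ρ.val z = 0) (n : ℕ) (x : List R) :
    dot ρ (List.replicate n z) x = 0 := by
  induction n generalizing x with
  | zero => simp [dot]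
  | succ n ih =>
    cases x with
    | nil => simp [dot]
    | cons y x => rw [List.replicate_succ, dot_cons, ih, hz]; simp

theorem dot_eq_sum (l : List ρ.IsCode) (z : ρ.IsCode) {n : ℕ} (x : Fin n → R)
    (h : l.length = n) : dot ρ l (List.ofFn x) = ∑ j : Fin n, ρ.val (l.getD j z) * x j := by
  rw [dot, ← List.sum_ofFn]
  congr 1
  refine List.ext_getElem (by simp [h]) fun i h₁ h₂ => ?_
  simp at h₁ h₂
  simp [List.getD_eq_getElem?_getD, h₁]

theorem ofFn_getD {α : Type*} (l : List α) (z : α) {n : ℕ} (h : l.length = n) :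
    (List.ofFn fun j : Fin n => l.getD j z) = l := by
  refine List.ext_getElem (by simp [h]) fun i h₁ h₂ => ?_
  simp [List.getD_eq_getElem?_getD, h₂]

theorem flatten_ofFn_get {α β : Type*} (l : List α) (f : α → List β) :
    (List.ofFn fun i : Fin l.length => f (l.get i)).flatten = l.flatMap f := by
  have : (List.ofFn fun i : Fin l.length => f (l.get i)) = l.map f := by
    refine List.ext_getElem (by simp) fun i h₁ h₂ => ?_
    simp
  rw [this, List.flatMap]

end Dot

/-! ### Correctness of the system -/

namespace RoundingProgram

variable {R : Type*} [CommRing R] {ρ : BitRep R} {I : Type} {ar : I → ℕ} {E Γ₁ : Type}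

/-- The equations that the program writes for a single clause describe the template `T`. -/
structure Describes (P : RoundingProgram ρ ar E Γ₁) (R' : Subring R) (T : Template R ar) :
    Prop where
  val_zero : ρ.val P.zero = 0
  val_negOne : ρ.val P.negOne = -1
  length_coeff : ∀ r, (P.coeff r).length = P.size r.1
  mem_iff : ∀ i y, y ∈ T i ↔ ∃ L : List R, L.length = P.size i ∧ (∀ a ∈ L, a ∈ R') ∧
    dot ρ (P.coeff ⟨i, none⟩) L = ρ.val (P.rhs ⟨i, none⟩) ∧
    ∀ j, dot ρ (P.coeff ⟨i, some j⟩) L - y j = ρ.val (P.rhs ⟨i, some j⟩)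

variable {P : RoundingProgram ρ ar E Γ₁} {R' : Subring R} {T : Template R ar}

namespace Describes

variable (hP : P.Describes R' T)

include hP

theorem dot_row {n a b : ℕ} {r : Row ar} {v : Option ℕ} {W A L B : List R}
    (hv : (P.varCoeff n v).length = W.length) (ha : A.length = a) (hL : L.length = P.size r.1) :
    dot ρ (P.row n a b r v).1 (W ++ (A ++ (L ++ B))) =
      dot ρ (P.varCoeff n v) W + dot ρ (P.coeff r) L := by
  rw [row]
  simp only [List.append_assoc]
  rw [dot_append hv, dot_append (by simp [ha]), dot_append (by rw [hP.length_coeff, hL]),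
    dot_replicate_zero hP.val_zero, dot_replicate_zero hP.val_zero, add_zero, zero_add]

theorem dot_varCoeff {n : ℕ} (w : Fin n → R) (v : Fin n) :
    dot ρ (P.varCoeff n (some v.val)) (List.ofFn w) = -w v := by
  have h₁ : (List.ofFn w).take v ++ w v :: (List.ofFn w).drop (v + 1) = List.ofFn w := by
    have := List.drop_eq_getElem_cons (l := List.ofFn w) (i := v) (by simp)
    rw [List.getElem_ofFn] at this
    rw [← this, List.take_append_drop]
  rw [← h₁, varCoeff, dot_append (by simp), dot_cons, dot_replicate_zero hP.val_zero,
    dot_replicate_zero hP.val_zero, hP.val_negOne]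
  simp

theorem clauseRows_iff {n a b : ℕ} (c : Σ i : I, Fin (ar i) → Fin n) (w : Fin n → R)
    {A L B : List R} (ha : A.length = a) (hL : L.length = P.size c.1) :
    (∀ r ∈ P.clauseRows n a b c, dot ρ r.1 (List.ofFn w ++ (A ++ (L ++ B))) = ρ.val r.2) ↔
      dot ρ (P.coeff ⟨c.1, none⟩) L = ρ.val (P.rhs ⟨c.1, none⟩) ∧
      ∀ j, dot ρ (P.coeff ⟨c.1, some j⟩) L - w (c.2 j) = ρ.val (P.rhs ⟨c.1, some j⟩) := by
  simp only [clauseRows, List.forall_mem_cons, List.forall_mem_ofFn_iff]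
  refine and_congr ?_ (forall_congr' fun j => ?_)
  · rw [hP.dot_row (by simp [varCoeff]) ha hL, varCoeff, dot_replicate_zero hP.val_zero, zero_add]
    rfl
  · rw [hP.dot_row (by simp [varCoeff]; omega) ha hL, hP.dot_varCoeff, neg_add_eq_sub]
    rfl

/-- The list `A` collects the unknowns of earlier clauses. Each clause meets zeros outside the
variables and its own block, so its equations decide membership in `T` independently. -/
theorem satisfied_of_rows {n : ℕ} (w : Fin n → R) (cs : List (Σ i : I, Fin (ar i) → Fin n))
    (A L : List R) (hL : L.length = P.totalSize cs) (hR : ∀ y ∈ L, y ∈ R')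
    (h : ∀ r ∈ P.rows n A.length cs, dot ρ r.1 (List.ofFn w ++ (A ++ L)) = ρ.val r.2) :
    ∀ c ∈ cs, w ∘ c.2 ∈ T c.1 := by
  induction cs generalizing A L with
  | nil => simp
  | cons c cs ih =>
    have e : P.totalSize (c :: cs) = P.size c.1 + P.totalSize cs := by simp [totalSize]
    rw [e] at hL
    have hL₁ : (L.take (P.size c.1)).length = P.size c.1 := by simp; omega
    rw [← List.take_append_drop (P.size c.1) L] at h
    rw [rows] at h
    simp only [List.mem_append, or_imp, forall_and] at h
    refine List.forall_mem_cons.2 ⟨?_, ih (A ++ L.take (P.size c.1)) (L.drop (P.size c.1)) ?_ ?_ ?_⟩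
    · exact (hP.mem_iff _ _).2 ⟨_, hL₁, fun y hy => hR y (List.mem_of_mem_take hy),
        (hP.clauseRows_iff c w rfl hL₁).1 h.1⟩
    · simp; omega
    · exact fun y hy => hR y (List.mem_of_mem_drop hy)
    · rw [List.length_append, hL₁, List.append_assoc]
      exact h.2

/-- `L` is chosen before `A`: the coefficients for `cs` do not depend on the earlier ones, so the
blocks of the single clauses can be concatenated. -/
theorem rows_of_satisfied {n : ℕ} (w : Fin n → R) (cs : List (Σ i : I, Fin (ar i) → Fin n))
    (h : ∀ c ∈ cs, w ∘ c.2 ∈ T c.1) :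
    ∃ L : List R, L.length = P.totalSize cs ∧ (∀ y ∈ L, y ∈ R') ∧ ∀ A : List R,
      ∀ r ∈ P.rows n A.length cs, dot ρ r.1 (List.ofFn w ++ (A ++ L)) = ρ.val r.2 := by
  induction cs with
  | nil => exact ⟨[], rfl, by simp, by simp [rows]⟩
  | cons c cs ih =>
    rw [List.forall_mem_cons] at h
    obtain ⟨L, hL, hR, hr⟩ := ih h.2
    obtain ⟨L₁, hL₁, hR₁, hr₁⟩ := (hP.mem_iff _ _).1 h.1
    refine ⟨L₁ ++ L, by simp [hL, hL₁, totalSize], ?_, fun A r hr' => ?_⟩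
    · simp only [List.mem_append]
      rintro y (hy | hy)
      exacts [hR₁ y hy, hR y hy]
    · rw [rows, List.mem_append] at hr'
      rcases hr' with hr' | hr'
      · exact (hP.clauseRows_iff c w rfl hL₁).2 hr₁ r hr'
      · have := hr (A ++ L₁) r (by rwa [List.length_append, hL₁])
        rwa [List.append_assoc] at this

theorem length_of_mem_rows {n a : ℕ} (cs : List (Σ i : I, Fin (ar i) → Fin n))
    (r : List ρ.IsCode × ρ.IsCode) (hr : r ∈ P.rows n a cs) :
    r.1.length = n + a + P.totalSize cs := by
  induction cs generalizing a with
  | nil => simp [rows] at hr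
  | cons c cs ih =>
    have e : P.totalSize (c :: cs) = P.size c.1 + P.totalSize cs := by simp [totalSize]
    rw [rows, List.mem_append] at hr
    rcases hr with hr | hr
    · simp only [clauseRows, List.mem_cons, List.mem_ofFn] at hr
      rcases hr with rfl | ⟨j, rfl⟩
      · simp [row, varCoeff, hP.length_coeff, e, add_assoc]
      · simp [row, varCoeff, hP.length_coeff, e]; omega
    · rw [ih hr, e]; omega

end Describes

/-- The system that the program writes for a formula. -/
def system (P : RoundingProgram ρ ar E Γ₁) (Ψ : Formula ar) : LinSystem ρ where
  m := (P.rows Ψ.n 0 Ψ.clauses).length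
  n := Ψ.n + P.totalSize Ψ.clauses
  restricted j := decide (Ψ.n ≤ j)
  A i j := ((P.rows Ψ.n 0 Ψ.clauses).get i).1.getD j P.zero
  b i := ((P.rows Ψ.n 0 Ψ.clauses).get i).2

/-- All rows have as many coefficients as there are unknowns, so the default of `getD` in `system`
is never used and no entry is lost. -/
theorem Describes.encode_system (hP : P.Describes R' T) (Ψ : Formula ar) :
    (P.system Ψ).encode = P.systemString Ψ := by
  have h₁ : (List.ofFn (P.system Ψ).restricted).map Sym.bit =
      List.replicate Ψ.n (Sym.bit false) ++
        List.replicate (P.totalSize Ψ.clauses) (Sym.bit true) := by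
    refine List.ext_getElem (by simp [system]) fun i h₁ h₂ => ?_
    simp only [List.getElem_map, List.getElem_ofFn, List.getElem_append, List.length_replicate,
      List.getElem_replicate, system]
    split_ifs with h <;> (simp [h]; try omega)
  have h₂ : (fun i =>
      ((List.ofFn ((P.system Ψ).A i)).flatMap fun a => encodeWord (a : List Bool)) ++
      encodeWord ((P.system Ψ).b i : List Bool) ++ [Sym.semicolon]) =
      fun i => encodeRow ((P.rows Ψ.n 0 Ψ.clauses).get i) := by
    funext i
    have e : List.ofFn ((P.system Ψ).A i) = ((P.rows Ψ.n 0 Ψ.clauses).get i).1 :=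
      ofFn_getD _ _ ((hP.length_of_mem_rows _ _ (List.get_mem _ _)).trans (by simp [system]))
    rw [e, flatMap_encodeWord_coe]; rfl
  rw [LinSystem.encode, h₁, h₂, systemString]
  congr 1
  exact flatten_ofFn_get _ _

theorem Describes.isSolution_iff (hP : P.Describes R' T) (Ψ : Formula ar) (w : Fin Ψ.n → R)
    (y : Fin (P.totalSize Ψ.clauses) → R) :
    (P.system Ψ).IsSolution R' (Fin.append w y) ↔
      (∀ r ∈ P.rows Ψ.n 0 Ψ.clauses, dot ρ r.1 (List.ofFn w ++ List.ofFn y) = ρ.val r.2) ∧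
        ∀ j, y j ∈ R' := by
  refine and_congr ?_ ?_
  · rw [List.forall_mem_iff_get]
    refine forall_congr' fun i => ?_
    rw [← List.ofFn_fin_append, dot_eq_sum _ P.zero]
    · rfl
    · exact (hP.length_of_mem_rows _ _ (List.get_mem _ _)).trans (by simp)
  · change (∀ j : Fin (Ψ.n + P.totalSize Ψ.clauses), decide (Ψ.n ≤ j) = true →
      Fin.append w y j ∈ R') ↔ _
    rw [Fin.forall_fin_add]
    simp [Fin.append_left, Fin.append_right]

/-- A solution of the system yields a solution of the relaxation. -/
theorem Describes.satisfiedBy (hP : P.Describes R' T) (Ψ : Formula ar)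
    (x : Fin (Ψ.n + P.totalSize Ψ.clauses) → R) (hx : (P.system Ψ).IsSolution R' x) :
    Ψ.SatisfiedBy T fun j => x (Fin.castAdd _ j) := by
  have e : x = Fin.append (fun j => x (Fin.castAdd _ j)) fun j => x (Fin.natAdd _ j) := by
    rw [Fin.append_castAdd_natAdd]
  rw [e, hP.isSolution_iff] at hx
  exact hP.satisfied_of_rows _ _ [] _ (List.length_ofFn ..)
    (List.forall_mem_ofFn_iff.2 hx.2) hx.1

theorem Describes.exists_isSolution (hP : P.Describes R' T) (Ψ : Formula ar)
    (h : Ψ.Satisfiable T) : ∃ x, (P.system Ψ).IsSolution R' x := by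
  obtain ⟨w, hw⟩ := h
  obtain ⟨L, hL, hR, hr⟩ := hP.rows_of_satisfied w _ hw
  refine ⟨Fin.append w (fun j => L.get (Fin.cast hL.symm j)), ?_⟩
  have e : (List.ofFn fun j => L.get (Fin.cast hL.symm j)) = L :=
    List.ext_getElem (by simp [hL]) fun i h₁ h₂ => by simp
  rw [hP.isSolution_iff, e]
  exact ⟨hr [], fun j => hR _ (List.get_mem _ _)⟩

end RoundingProgram

/-! ## The program for a promise template -/

section Program

variable {R : Type*} [CommRing R] {ρ : BitRep R}

theorem dot_ofFn {m : ℕ} (c : Fin m → ρ.IsCode) (L : Fin m → R) :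
    dot ρ (List.ofFn c) (List.ofFn L) = ∑ k, ρ.val (c k) * L k := by
  rw [dot, ← List.sum_ofFn]
  congr 1
  exact List.ext_getElem (by simp) fun i h₁ h₂ => by simp

/-- Affine combinations of the members of a finite family. -/
theorem mem_affineHull_range_iff (R' : Subring R) {m k : ℕ} (s : Fin m → Fin k → R)
    (y : Fin k → R) : y ∈ affineHull R' (Set.range s) ↔
      ∃ L : Fin m → R, (∀ i, L i ∈ R') ∧ ∑ i, L i = 1 ∧ ∀ j, ∑ i, s i j * L i = y j := by
  constructor
  · rintro ⟨l, r, t, ht, hr, rfl⟩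
    choose idx hidx using ht
    -- Coefficients of equal members are collected. The case `f = 1` gives the normalization, and `f
    -- i = s i j` gives the `j`-th coordinate.
    have key : ∀ f : Fin m → R, ∑ i, f i * ∑ j with idx j = i, (r j : R) =
        ∑ j, f (idx j) * r j := by
      intro f
      rw [← Finset.sum_fiberwise Finset.univ idx]
      refine Finset.sum_congr rfl fun i _ => ?_
      rw [Finset.mul_sum]
      refine Finset.sum_congr rfl fun j hj => ?_
      rw [(Finset.mem_filter.1 hj).2]
    refine ⟨fun i => ∑ j with idx j = i, (r j : R), fun i => sum_mem fun j _ => (r j).2, ?_,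
      fun j => ?_⟩
    · have := key fun _ => 1
      simp only [one_mul] at this
      rw [this]
      exact_mod_cast congrArg (Subtype.val : R' → R) hr
    · rw [key fun i => s i j, Finset.sum_apply]
      refine Finset.sum_congr rfl fun i _ => ?_
      rw [hidx, Pi.smul_apply, smul_eq_mul, mul_comm]
  · rintro ⟨L, hL, h₁, h⟩
    refine ⟨m, fun i => ⟨L i, hL i⟩, s, fun i => ⟨i, rfl⟩, Subtype.ext (by simpa using h₁), ?_⟩
    funext j
    rw [← h j, Finset.sum_apply]
    exact Finset.sum_congr rfl fun i _ => by rw [Pi.smul_apply, smul_eq_mul, mul_comm]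

variable {I : Type} {ar : I → ℕ} {D E Γ₁ : Type} [Finite D]

/-- The program that solves the affine relaxation of formulae over the template `T`. -/
noncomputable def relaxationProgram (M : Turing.TM2ComputableAux Sym Sym) (ρ : BitRep R)
    (T : Template D ar) (g : D → R) (emit : E → List Γ₁) (accept reject : List Γ₁) :
    RoundingProgram ρ ar E Γ₁ where
  solver := M
  -- Codes are chosen once for the template and independently of the formula, so the noncomputable
  -- choice only fixes constants of the machine.
  zero := Function.surjInv ρ.surj 0
  negOne := Function.surjInv ρ.surj (-1)
  size i := Nat.card (T i)
  coeff
    | ⟨i, none⟩ => List.ofFn fun _ : Fin (Nat.card (T i)) => Function.surjInv ρ.surj 1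
    | ⟨i, some j⟩ => List.ofFn fun k =>
      Function.surjInv ρ.surj (g (((Finite.equivFin (T i)).symm k).1 j))
  rhs
    | ⟨_, none⟩ => Function.surjInv ρ.surj 1
    | ⟨_, some _⟩ => Function.surjInv ρ.surj 0
  emit := emit
  accept := accept
  reject := reject

theorem describes_relaxationProgram (M : Turing.TM2ComputableAux Sym Sym) (R' : Subring R)
    (T : Template D ar) (g : D → R) (emit : E → List Γ₁) (accept reject : List Γ₁) :
    (relaxationProgram M ρ T g emit accept reject).Describes R' (affineRelaxation R' T g) where
  val_zero := Function.surjInv_eq _ _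
  val_negOne := Function.surjInv_eq _ _
  length_coeff := by rintro ⟨i, _ | j⟩ <;> exact List.length_ofFn ..
  mem_iff i y := by
    have hs : (fun x => g ∘ x) '' T i =
        Set.range fun k => g ∘ ((Finite.equivFin (T i)).symm k).1 := by
      rw [Set.image_eq_range]
      exact ((Finite.equivFin (T i)).symm.surjective.range_comp fun x : T i => g ∘ x.1).symm
    have hval : ∀ r, ρ.val (Function.surjInv ρ.surj r) = r := Function.surjInv_eq _
    rw [affineRelaxation, hs, mem_affineHull_range_iff]
    constructor
    · rintro ⟨L, hL, h₁, h⟩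
      refine ⟨List.ofFn L, List.length_ofFn .., List.forall_mem_ofFn_iff.2 hL,
        (dot_ofFn _ _).trans ?_, fun j => ?_⟩
      · simp only [hval, one_mul]
        exact h₁.trans (hval 1).symm
      · refine Eq.trans ?_ (hval 0).symm
        rw [sub_eq_zero, ← h j]
        refine (dot_ofFn _ _).trans ?_
        simp only [hval]; rfl
    · rintro ⟨L, hL, hR, h₁, h⟩
      change L.length = Nat.card (T i) at hL
      obtain ⟨L, rfl⟩ : ∃ L' : Fin (Nat.card (T i)) → R, L = List.ofFn L' :=
        ⟨fun k => L.get (Fin.cast hL.symm k),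
          List.ext_getElem (by simp [hL]) fun i h₁ h₂ => by rw [List.getElem_ofFn]; rfl⟩
      refine ⟨L, List.forall_mem_ofFn_iff.1 hR, ?_, fun j => ?_⟩
      · have := ((dot_ofFn _ _).symm.trans h₁).trans (hval 1)
        simpa only [hval, one_mul] using this
      · have := sub_eq_zero.1 ((h j).trans (hval 0))
        rw [← this]
        refine Eq.symm ((dot_ofFn _ _).trans ?_)
        simp only [hval]; rfl

end Program

/-! ## The length of the system -/

namespace RoundingProgram

variable {R : Type*} {ρ : BitRep R} {I : Type} {ar : I → ℕ} {E Γ₁ : Type}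

/-- A clause yields `ar + 1` equations, and its word has a relation symbol and at least an end mark
per variable. -/
theorem rowCount_add_le_length (Ψ : Formula ar) :
    Ψ.n + 1 + rowCount Ψ.clauses ≤ (encodeFormula Ψ).length := by
  have aux : ∀ l : List (Fin Ψ.n), l.length ≤
      (l.flatMap fun v => encodeIndex (I := I) v.val).length := by
    intro l
    induction l with
    | nil => simp
    | cons v l ih =>
      rw [List.flatMap_cons, List.length_append, List.length_cons]
      simp only [encodeIndex, List.length_append, List.length_singleton] at ih ⊢
      omega
  have h : ∀ cs : List (Σ i : I, Fin (ar i) → Fin Ψ.n), rowCount cs ≤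
      (cs.flatMap encodeClause).length := by
    intro cs
    induction cs with
    | nil => simp [rowCount]
    | cons c cs ih =>
      have := aux (List.ofFn c.2)
      rw [List.length_ofFn] at this
      rw [List.flatMap_cons, List.length_append, encodeClause, List.length_cons]
      simp only [rowCount, List.map_cons, List.sum_cons] at ih ⊢
      omega
  have e : encodeFormula Ψ = encodeIndex Ψ.n ++ Ψ.clauses.flatMap encodeClause := rfl
  rw [e, List.length_append, encodeIndex, List.length_append, List.length_replicate,
    List.length_singleton]
  have := h Ψ.clauses
  omega

variable (P : RoundingProgram ρ ar E Γ₁)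

theorem totalSize_le {s : ℕ} (hs : ∀ i, P.size i ≤ s) {n : ℕ}
    (cs : List (Σ i : I, Fin (ar i) → Fin n)) : P.totalSize cs ≤ s * rowCount cs := by
  induction cs with
  | nil => simp [totalSize]
  | cons c cs ih =>
    simp only [totalSize, rowCount, List.map_cons, List.sum_cons] at ih ⊢
    have := hs c.1
    have : s * 1 ≤ s * (ar c.1 + 1) := Nat.mul_le_mul_left _ (by omega)
    rw [mul_add]
    omega

theorem totalSize_le_length {s : ℕ} (hs : ∀ i, P.size i ≤ s) (Ψ : Formula ar) :
    P.totalSize Ψ.clauses ≤ s * (encodeFormula Ψ).length :=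
  (P.totalSize_le hs _).trans
    (Nat.mul_le_mul_left _ (by have := rowCount_add_le_length Ψ; omega))

theorem length_rows {n a : ℕ} (cs : List (Σ i : I, Fin (ar i) → Fin n)) :
    (P.rows n a cs).length = rowCount cs := by
  induction cs generalizing a with
  | nil => rfl
  | cons c cs ih => simp [rows, ih, clauseRows, rowCount]; omega

theorem length_flatMap_le {α β : Type*} (l : List α) (f : α → List β) (b : ℕ)
    (h : ∀ a ∈ l, (f a).length ≤ b) : (l.flatMap f).length ≤ l.length * b := by
  induction l with
  | nil => simp
  | cons a l ih =>
    rw [List.forall_mem_cons] at h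
    rw [List.flatMap_cons, List.length_append, List.length_cons, add_mul, one_mul, add_comm]
    exact add_le_add (ih h.2) h.1

/-- All words that the program writes have length at most `w`. -/
def WordsLe (w : ℕ) : Prop :=
  (wordOf P.zero).length ≤ w ∧ (wordOf P.negOne).length ≤ w ∧
    ∀ r, (wordOf (P.rhs r)).length ≤ w ∧ ∀ a ∈ P.coeff r, (wordOf a).length ≤ w

theorem exists_wordsLe [Finite I] : ∃ w, P.WordsLe w := by
  obtain ⟨b, hb⟩ := Finite.exists_le fun r => (wordOf (P.rhs r)).length
  obtain ⟨c, hc⟩ := Finite.exists_le fun r => ((P.coeff r).flatMap wordOf).length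
  refine ⟨(wordOf P.zero).length + (wordOf P.negOne).length + b + c, by omega, by omega,
    fun r => ⟨(hb r).trans (by omega), fun a ha => ?_⟩⟩
  have : (wordOf a).length ≤ ((P.coeff r).flatMap wordOf).length := by
    rw [List.length_flatMap]
    exact List.single_le_sum (by simp) _ (List.mem_map_of_mem ha)
  have := hc r
  omega

theorem WordsLe.of_mem_rows {P : RoundingProgram ρ ar E Γ₁} {w : ℕ} (h : P.WordsLe w) {n a : ℕ}
    (cs : List (Σ i : I, Fin (ar i) → Fin n)) (r) (hr : r ∈ P.rows n a cs) :
    (wordOf r.2).length ≤ w ∧ ∀ a ∈ r.1, (wordOf a).length ≤ w := by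
  have aux : ∀ n a b r v, (wordOf (P.row n a b r v).2).length ≤ w ∧
      ∀ x ∈ (P.row n a b r v).1, (wordOf x).length ≤ w := by
    intro n a b r v
    refine ⟨(h.2.2 r).1, fun x hx => ?_⟩
    have hz : ∀ m, x ∈ List.replicate m P.zero → (wordOf x).length ≤ w :=
      fun m hm => List.eq_of_mem_replicate hm ▸ h.1
    rcases v with _ | v
    · simp only [row, varCoeff, List.mem_append] at hx
      rcases hx with ((hx | hx) | hx) | hx
      exacts [hz _ hx, hz _ hx, (h.2.2 r).2 x hx, hz _ hx]
    · simp only [row, varCoeff, List.mem_append, List.mem_cons] at hx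
      rcases hx with (((hx | hx | hx) | hx) | hx) | hx
      exacts [hz _ hx, hx ▸ h.2.1, hz _ hx, hz _ hx, (h.2.2 r).2 x hx, hz _ hx]
  induction cs generalizing a with
  | nil => simp [rows] at hr
  | cons c cs ih =>
    rw [rows, List.mem_append] at hr
    rcases hr with hr | hr
    · simp only [clauseRows, List.mem_cons, List.mem_ofFn] at hr
      rcases hr with rfl | ⟨j, rfl⟩ <;> exact aux _ _ _ _ _
    · exact ih hr

theorem length_encodeRow_le {w : ℕ} (r : List ρ.IsCode × ρ.IsCode)
    (h : (wordOf r.2).length ≤ w ∧ ∀ a ∈ r.1, (wordOf a).length ≤ w) :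
    (encodeRow r).length ≤ (r.1.length + 1) * w + 1 := by
  have := length_flatMap_le r.1 wordOf w h.2
  rw [encodeRow, List.length_append, List.length_append, List.length_singleton, add_mul, one_mul]
  omega

open Polynomial

/-- A bound for the length of the system. -/
noncomputable def systemBound (s w : ℕ) : ℕ[X] :=
  X + C s * X + 1 + X * ((X + C s * X + 1) * C w + 1)

/-- A bound for the number of steps before the solver starts. -/
noncomputable def genBound (s w : ℕ) : ℕ[X] :=
  4 * X + X * (2 * (X + C s * X) + 10) + systemBound s w + 10

/-- A bound for the running time. -/
noncomputable def timeBound (s w b : ℕ) (p : ℕ[X]) : ℕ[X] :=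
  genBound s w + p.comp (systemBound s w) +
    6 * (systemBound s w + p.comp (systemBound s w) * C b) + X + C s * X + 8

/-- Polynomials over `ℕ` are monotone, so bounds on the length of the system pass through the time
bound of the solver. -/
theorem eval_mono (p : ℕ[X]) {m n : ℕ} (h : m ≤ n) : p.eval m ≤ p.eval n := by
  rw [Polynomial.eval_eq_sum, Polynomial.eval_eq_sum]
  exact Finset.sum_le_sum fun i _ => Nat.mul_le_mul_left _ (Nat.pow_le_pow_left h i)

end RoundingProgram

/-! ### Polynomial running time -/

namespace RoundingProgram

open Polynomial

variable {R : Type*} [CommRing R] {ρ : BitRep R} {I : Type} {ar : I → ℕ} {E Γ₁ : Type}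
  {P : RoundingProgram ρ ar E Γ₁} {R' : Subring R} {T : Template R ar} {s w : ℕ}

/-- With `L` the length of the formula, there are at most `L` equations, each with at most `L + s *
L + 1` words of length at most `w`, and a semicolon. -/
theorem Describes.length_systemString_le (hP : P.Describes R' T) (hs : ∀ i, P.size i ≤ s)
    (hw : P.WordsLe w) (Ψ : Formula ar) :
    (P.systemString Ψ).length ≤ (systemBound s w).eval (encodeFormula Ψ).length := by
  set L := (encodeFormula Ψ).length with hL
  have h₁ := rowCount_add_le_length Ψ
  have h₂ := P.totalSize_le_length hs Ψ
  rw [← hL] at h₁ h₂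
  have h₃ : ((P.rows Ψ.n 0 Ψ.clauses).flatMap encodeRow).length ≤
      L * ((L + s * L + 1) * w + 1) := by
    refine (length_flatMap_le _ _ ((L + s * L + 1) * w + 1) fun r hr => ?_).trans ?_
    · refine (length_encodeRow_le r (hw.of_mem_rows _ r hr)).trans ?_
      rw [hP.length_of_mem_rows _ r hr]
      gcongr
      omega
    · rw [P.length_rows]
      gcongr
      omega
  simp only [systemString, systemBound, List.length_append, List.length_replicate,
    List.length_singleton, eval_add, eval_mul, eval_X, eval_C, eval_one]
  omega

theorem Describes.genTime_le (hP : P.Describes R' T) (hs : ∀ i, P.size i ≤ s)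
    (hw : P.WordsLe w) (Ψ : Formula ar) :
    P.genTime Ψ ≤ (genBound s w).eval (encodeFormula Ψ).length := by
  have h₁ := rowCount_add_le_length Ψ
  have h₂ := P.totalSize_le_length hs Ψ
  have h₃ := hP.length_systemString_le hs hw Ψ
  rw [genTime, genBound]
  simp only [eval_add, eval_mul, eval_X, eval_C, eval_ofNat]
  have : rowCount Ψ.clauses * (2 * (Ψ.n + P.totalSize Ψ.clauses) + 10) ≤
      (encodeFormula Ψ).length *
        (2 * ((encodeFormula Ψ).length + s * (encodeFormula Ψ).length) + 10) := by
    gcongr <;> omega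
  omega

/-- The answer of the program for an assignment, or for "reject". -/
def answer (P : RoundingProgram ρ ar E Γ₁) {n : ℕ} : Option (Fin n → E) → List Γ₁
  | none => P.reject
  | some y => (List.ofFn y).flatMap P.emit ++ P.accept

/-- The rounding machine runs in polynomial time, and rounds a solution of the template `T` that
the program describes, or rejects if there is none. -/
theorem Describes.exists_polynomial [Finite I] [Finite E] (hP : P.Describes R' T) (h : R → E)
    (p : ℕ[X]) (hM : ∀ S : LinSystem ρ, ∃ out : Option (Fin S.n → ρ.IsCode),
      S.CorrectAnswer R' out ∧ Nonempty (Turing.TM2OutputsInTime P.solver.tm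
        (S.encode.map P.solver.inputAlphabet.invFun)
        (some ((encodeSolution out).map P.solver.outputAlphabet.invFun))
        (p.eval S.encode.length))) :
    ∃ q : ℕ[X], ∀ O : List Bool → E, IsOracleFor ρ h O → ∀ Ψ : Formula ar,
      ∃ out : Option (Fin Ψ.n → E),
        ((out = none ∧ ¬ Ψ.Satisfiable T) ∨
          ∃ x : Fin Ψ.n → R, Ψ.SatisfiedBy T x ∧ out = some (h ∘ x)) ∧
        P.machine.OutputsInTime O (encodeFormula Ψ) (P.answer out)
          (q.eval (encodeFormula Ψ).length) := by
  obtain ⟨s, hs⟩ := Finite.exists_le P.size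
  obtain ⟨w, hw⟩ := P.exists_wordsLe
  have := P.solver.tm.ΛFin
  obtain ⟨b, hb⟩ := Finite.exists_le fun l => pushCount (P.solver.tm.m l)
  refine ⟨timeBound s w b p, fun O hO Ψ => ?_⟩
  have h₁ := rowCount_add_le_length Ψ
  have h₂ := P.totalSize_le_length hs Ψ
  have h₃ := hP.length_systemString_le hs hw Ψ
  have h₄ := hP.genTime_le hs hw Ψ
  have h₅ := eval_mono p h₃
  have mono : ∀ {l t t'}, P.machine.OutputsInTime O (encodeFormula Ψ) l t → t ≤ t' →
      P.machine.OutputsInTime O (encodeFormula Ψ) l t' :=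
    fun ⟨h⟩ ht => ⟨⟨h.toEvalsTo, h.steps_le_m.trans ht⟩⟩
  obtain ⟨out, hout, hrun⟩ := hM (P.system Ψ)
  rw [hP.encode_system] at hrun
  have heval : (timeBound s w b p).eval (encodeFormula Ψ).length =
      (genBound s w).eval (encodeFormula Ψ).length +
      p.eval ((systemBound s w).eval (encodeFormula Ψ).length) +
      6 * ((systemBound s w).eval (encodeFormula Ψ).length +
        p.eval ((systemBound s w).eval (encodeFormula Ψ).length) * b) +
      (encodeFormula Ψ).length + s * (encodeFormula Ψ).length + 8 := by
    simp only [timeBound, eval_add, eval_mul, eval_X, eval_C, eval_ofNat, eval_comp]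
  rcases out with _ | x
  · refine ⟨none, .inl ⟨rfl, fun hsat => hout (hP.exists_isSolution Ψ hsat)⟩, ?_⟩
    refine mono (outputsInTime_reject Ψ _ hrun) ?_
    rw [heval]
    omega
  · change Fin (Ψ.n + P.totalSize Ψ.clauses) → ρ.IsCode at x
    have e : encodeSolution (some x) =
        Sym.bit true :: (List.ofFn fun j => (x j : List Bool)).flatMap encodeWord := by
      rw [encodeSolution, flatMap_encodeWord_coe]
      congr 1
      simp [List.flatMap, List.map_ofFn, wordOf, Function.comp_def]
    change Nonempty (Turing.TM2OutputsInTime _ _ (some ((encodeSolution (some x)).map _)) _) at hrun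
    have hlen := length_le_of_outputsInTime _ b hb _ _ _ hrun
    rw [e] at hrun hlen
    have hacc := outputsInTime_accept (O := O) Ψ _ _ (by simp) hrun
    -- A valid oracle answers by the value of a code, so it does not matter which code the solver
    -- has chosen.
    have htake : ((List.ofFn fun j => (x j : List Bool)).take Ψ.n).map O =
        List.ofFn (h ∘ fun j : Fin Ψ.n => ρ.val (x (Fin.castAdd _ j))) := by
      refine List.ext_getElem (by simp) fun i h₁ h₂ => ?_
      simp only [List.getElem_map, List.getElem_take, List.getElem_ofFn, hO (x _)]
      rfl
    rw [htake] at hacc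
    refine ⟨some (h ∘ fun j => ρ.val (x (Fin.castAdd _ j))),
      .inr ⟨_, hP.satisfiedBy Ψ _ hout, rfl⟩, mono hacc ?_⟩
    rw [heval]
    simp only [List.length_map, List.length_cons] at hlen
    have h₆ := Nat.mul_le_mul_right b h₅
    omega

end RoundingProgram

/-! ### The sandwich and the theorem -/

/-- An affine combination of affine combinations has coefficients `r j * c j k`, indexed by a
disjoint union; they sum up to `∑ j, r j * 1 = 1`. -/
theorem affineHull_subset {R : Type*} [CommRing R] (R' : Subring R) {k : ℕ}
    {S S' : Set (Fin k → R)} (h : S ⊆ affineHull R' S') : affineHull R' S ⊆ affineHull R' S' := by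
  rintro _ ⟨l, r, s, hs, hr, rfl⟩
  choose m c t ht hc e using fun j => h (hs j)
  let F : (Σ j, Fin (m j)) ≃ Fin (Fintype.card (Σ j, Fin (m j))) := Fintype.equivFin _
  refine ⟨_, fun i => r (F.symm i).1 * c _ (F.symm i).2, fun i => t _ (F.symm i).2,
    fun i => ht _ _, ?_, ?_⟩
  · rw [Equiv.sum_comp F.symm fun x => r x.1 * c x.1 x.2, Fintype.sum_sigma]
    simp only [← Finset.mul_sum, hc, mul_one, hr]
  · rw [Equiv.sum_comp F.symm fun x => ((r x.1 * c x.1 x.2 : R') : R) • t x.1 x.2,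
      Fintype.sum_sigma]
    refine Finset.sum_congr rfl fun j _ => ?_
    rw [e j, Finset.smul_sum]
    simp [mul_smul]

section Sandwich

variable {R : Type*} [CommRing R] {R' : Subring R} {D E I : Type} {φ : D → E} {ar : I → ℕ}
  {Γ : PromiseTemplate φ ar} {g : D → R} {h : R → E}

theorem isHom_affineRelaxation (R' : Subring R) (P : Template D ar) (g : D → R) :
    IsHom g P (affineRelaxation R' P g) :=
  fun _ x hx => ⟨1, fun _ => 1, fun _ => g ∘ x, fun _ => ⟨x, hx, rfl⟩, by simp, by simp⟩

/-- The generators of `T i` need not be related to `P i`. What counts is that `T i` is closed under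
affine combinations and contains `g(P i)`. -/
theorem isHom_of_sandwiches (hs : Γ.Sandwiches (LE R') g h) :
    IsHom h (affineRelaxation R' Γ.P g) Γ.Q := by
  obtain ⟨T, hT, hg, hh⟩ := hs
  intro i x hx
  obtain ⟨S, -, hS⟩ := hT i
  refine hh i x ?_
  rw [hS]
  refine affineHull_subset R' ?_ hx
  rintro _ ⟨y, hy, rfl⟩
  exact hS ▸ hg i y hy

theorem Formula.SatisfiedBy.map {F F' : Type*} {P : Template F ar} {P' : Template F' ar}
    {f : F → F'} (hf : IsHom f P P') {Ψ : Formula ar} {x : Fin Ψ.n → F}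
    (hx : Ψ.SatisfiedBy P x) : Ψ.SatisfiedBy P' (f ∘ x) :=
  fun c hc => hf c.1 _ (hx c hc)

end Sandwich

end PromiseCSP

theorem mainTheorem11 {R : Type*} [CommRing R] (ρ : PromiseCSP.BitRep R) (R' : Subring R)
    (hLE : PromiseCSP.LESolvablePair ρ R')
    {D E I : Type} [Finite D] [Finite E] [Finite I] (φ : D → E) (ar : I → ℕ)
    (Γ : PromiseCSP.PromiseTemplate φ ar) (g : D → R) (h : R → E)
    (hs : Γ.Sandwiches (PromiseCSP.LE R') g h) :
    PromiseCSP.InPOracle ρ h PromiseCSP.encodeFormula (PromiseCSP.PCSP Γ) ∧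
    PromiseCSP.PolyTimeWithOracle ρ h
      (α := PromiseCSP.Formula ar) (β := fun Ψ => Option (Fin Ψ.n → E))
      PromiseCSP.encodeFormula (fun _ out => PromiseCSP.encodeAssignment out)
      (fun Ψ out => PromiseCSP.SearchCorrect Γ Ψ out ∧
        PromiseCSP.RoundsAffineRelaxation Γ R' g h Ψ out) := by
  obtain ⟨M, p, hM⟩ := hLE
  have hg := PromiseCSP.isHom_affineRelaxation R' Γ.P g
  have hh := PromiseCSP.isHom_of_sandwiches hs
  constructor
  -- In the decision version the rounded values are emitted as empty words, which leaves only the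
  -- verdict.
  · obtain ⟨q, hq⟩ := (PromiseCSP.describes_relaxationProgram (ρ := ρ) M R' Γ.P g
      (fun _ : E => []) [true] [false]).exists_polynomial h p hM
    refine ⟨(PromiseCSP.relaxationProgram M ρ Γ.P g
      (fun _ : E => []) [true] [false]).machine, q, fun O hO Ψ => ?_⟩
    obtain ⟨out, ho, hrun⟩ := hq O hO Ψ
    rcases ho with ⟨rfl, hno⟩ | ⟨x, hx, rfl⟩
    -- A solution of `Ψ_P` would become a solution of the relaxation under `g`.
    · refine ⟨false, ⟨fun ⟨y, hy⟩ => (hno ⟨_, hy.map hg⟩).elim, fun _ => rfl⟩, hrun⟩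
    · refine ⟨true, ⟨fun _ => rfl, fun hno => (hno ⟨_, hx.map hh⟩).elim⟩, ?_⟩
      have e : (PromiseCSP.relaxationProgram M ρ Γ.P g
          (fun _ : E => []) [true] [false]).answer (some (h ∘ x)) = [true] := by
        simp [PromiseCSP.RoundingProgram.answer, PromiseCSP.relaxationProgram]
      rwa [e] at hrun
  · obtain ⟨q, hq⟩ := (PromiseCSP.describes_relaxationProgram (ρ := ρ) M R' Γ.P g
      (fun e : E => [some e]) [] [none]).exists_polynomial h p hM
    refine ⟨(PromiseCSP.relaxationProgram M ρ Γ.P g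
      (fun e : E => [some e]) [] [none]).machine, q, fun O hO Ψ => ?_⟩
    obtain ⟨out, ho, hrun⟩ := hq O hO Ψ
    refine ⟨out, ⟨fun ⟨y, hy⟩ => ?_, ho⟩, ?_⟩
    · rcases ho with ⟨-, hno⟩ | ⟨x, hx, rfl⟩
      · exact (hno ⟨_, hy.map hg⟩).elim
      · exact ⟨_, rfl, hx.map hh⟩
    · have e : (PromiseCSP.relaxationProgram M ρ Γ.P g
          (fun e : E => [some e]) [] [none]).answer out = PromiseCSP.encodeAssignment out := by
        cases out with
        | none => rfl
        | some y => exact (List.append_nil _).trans List.map_eq_flatMap.symm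
      rwa [e] at hrun
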